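/- **Model.** Let $K\ge 2$, $1\le s\le d$, $\sigma>0$, $p(t)=1/(1+e^{-t})$. An instance $\mu$ consists of $\theta^*,\beta_1^*,\beta_2^*\in\mathbb R^d$ with $\beta^*_1\neq\beta^*_2$ and a joint law of features $(x_1,\dots,x_K,z)\in(\mathbb R^d)^K\times\mathbb R^d$. Customers $i=1,\dots,T$ are i.i.d.: the features $(x_{i,1},\dots,x_{i,K},z_i)$ follow this law; given the features, the latent group is $g_i=1$ with probability $p(z_i^\top\theta^*)$ and $g_i=2$ otherwise; and $\epsilon_i\sim N(0,\sigma^2)$ is independent noise. A policy $\hat\pi$ chooses (possibly at random) an arm $\hat a_i\in[K]$ from the features of customer $i$ and the past features, arms and rewards; the reward is $\langle x_{i,\hat a_i},\beta^*_{g_i}\rangle+\epsilon_i$, and $g_i$ is never observed. Put $G(z)=1$ if $p(z^\top\theta^*)\ge 1/2$, $G(z)=2$ otherwise, $R(\theta^*)=\mathbb P(G(z)\ne g)$, and $\tilde a_i=\arg\max_k\langle x_{i,k},\beta^*_{G(z_i)}\rangle$. The cumulative strong and regular regrets are $$\mathrm{Reg}^*(T)=\sum_{i=1}^T\mathbb E\Big[\max_k\langle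 x_{i,k},\beta^*_{g_i}\rangle-\langle x_{i,\hat a_i},\beta^*_{g_i}\rangle\Big],\qquad \widetilde{\mathrm{Reg}}(T)=\sum_{i=1}^T\mathbb E\Big[\langle x_{i,\tilde a_i},\beta^*_{g_i}\rangle-\langle x_{i,\hat a_i},\beta^*_{g_i}\rangle\Big].$$ **Class.** For $\bar x,\bar L>0$ and constants $\xi\in(0,1/2)$, $M>1$, $\kappa,C,\bar h>0$, let $\mathcal P=\mathcal P_{d,s,\bar x,\bar L}$ be the set of instances such that $\theta^*,\beta_1^*,\beta_2^*$ have at most $s$ non-zero entries and * (A1) $\xi<p(z^\top\theta^*)<1-\xi$ almost surely; * (A4) for each $k$ the vector $(x_k,z)$ is sub-Gaussian with constant $\kappa$ (that is, $\mathbb E\exp(\langle u,(x_k,z)\rangle^2/\kappa^2)\le 2$ for all unit vectors $u$), and all eigenvalues of $\mathbb E[x_kx_k^\top]$ and of $\mathbb E[zz^\top]$ lie in $(1/M,M)$; * (B1) $\|x_k\|_\infty\le\bar x$ almost surely for all $k$, and $\|\beta_g^*\|_1\le\bar L$ for $g=1,2$; * (B2) for $g=1,2$ and $h\in[0,\bar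 h]$, with $a_g=\arg\max_k\langle x_k,\beta^*_g\rangle$: $\mathbb P\big(\langle x_{a_g},\beta_g^*\rangle\le\max_{k\ne a_g}\langle x_k,\beta^*_g\rangle+h\big)\le Ch$. **Theorem.** 1. There is a universal constant $c>0$ with the following property. For all $\bar x,\bar L>0$ there are $M_0,\kappa_0,h_0>0$ such that, for all $\xi\in(0,1/2)$, $M>1$ with $M\ge M_0$, $C>0$, $0<\bar h\le h_0$, $\kappa_z>0$, $\kappa\ge\kappa_0+\kappa_z$, $\sigma>0$, $K\ge2$, $1\le s\le d$, $T\ge 0$, for every $s$-sparse $\theta^*$ and every law of $z$ that satisfy (A1), are sub-Gaussian with constant $\kappa_z$ and have all eigenvalues of $\mathbb E[zz^\top]$ in $(1/M,M)$, and for every policy, some $\mu\in\mathcal P$ with this $\theta^*$ and this law of $z$ has $$\mathrm{Reg}^*(T)\ \ge\ c\,\bar x\,\bar L\,R(\theta^*)\,T .$$ 2. For all $A>0$ and $\xi\in(0,1/2)$ there is $c>0$ with the following property. For all $\bar x,\bar L>0$ there are $M_0,\kappa_0,h_0>0$ such that, for all $M>1$ with $M\ge M_0$, $\kappa\ge\kappa_0$,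 $C>0$, $0<\bar h\le h_0$, $\sigma>0$, $K\ge2$, all $1\le s\le d$ and $T\ge 0$ with $\log d\le A\log(d/s)$ and $s\log d\le A\,T$, and for every policy, some $\mu\in\mathcal P$ has $$\widetilde{\mathrm{Reg}}(T)\ \ge\ c\,\bar x\,\bar L\,\sqrt{s\log d}\,\sqrt T .$$ -/

import Mathlib

open MeasureTheory ProbabilityTheory
open scoped NNReal

noncomputable section

namespace LatentBandit

/-! ### The latent heterogeneous linear bandit model

Groups are labelled by `Fin 2`: label `0` is the first subgroup, label `1` is the second. -/

/-- The observable features of one customer: the vectors `x k` of the `K` arms and the customer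
feature `z`. -/
abbrev Ctx (K d : ℕ) : Type := (Fin K → Fin d → ℝ) × (Fin d → ℝ)

/-- Subgroup model: given `z`, the group is the first one with probability `p(zᵀθ)` and the second
one with probability `1 - p(zᵀθ)`, where `p` is the logistic function. -/
def groupKernel {d : ℕ} (θ : Fin d → ℝ) : Kernel (Fin d → ℝ) (Fin 2) where
  toFun z :=
    ENNReal.ofReal (Real.sigmoid (z ⬝ᵥ θ)) • Measure.dirac 0 +
      ENNReal.ofReal (1 - Real.sigmoid (z ⬝ᵥ θ)) • Measure.dirac 1
  measurable' := by
    have hm : Measurable fun z : Fin d → ℝ => Real.sigmoid (z ⬝ᵥ θ) :=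
      continuous_sigmoid.measurable.comp
        (Continuous.dotProduct continuous_id continuous_const).measurable
    refine Measure.measurable_of_measurable_coe _ fun s _ => ?_
    simp only [Measure.coe_add, Measure.coe_smul, Pi.add_apply, Pi.smul_apply, smul_eq_mul]
    exact (hm.ennreal_ofReal.mul_const _).add
      ((measurable_const.sub hm).ennreal_ofReal.mul_const _)

instance {d : ℕ} (θ : Fin d → ℝ) : IsMarkovKernel (groupKernel θ) where
  isProbabilityMeasure z := ⟨by
    change (ENNReal.ofReal (Real.sigmoid (z ⬝ᵥ θ)) • Measure.dirac (0 : Fin 2) +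
      ENNReal.ofReal (1 - Real.sigmoid (z ⬝ᵥ θ)) • Measure.dirac (1 : Fin 2)) Set.univ = 1
    simp only [Measure.coe_add, Measure.coe_smul, Pi.add_apply, Pi.smul_apply, smul_eq_mul,
      measure_univ, mul_one]
    rw [← ENNReal.ofReal_add (Real.sigmoid_nonneg _)
      (sub_nonneg.2 (Real.sigmoid_le_one _))]
    simp⟩

/-- A bandit instance with `K` arms in dimension `d`: the parameters `(θ, β₁, β₂)` and the joint
law of the features `(x, z)` of a customer. -/
structure Instance (K d : ℕ) where
  /-- parameter of the subgroup model -/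
  θ : Fin d → ℝ
  /-- parameters of the reward model, one for each group -/
  β : Fin 2 → Fin d → ℝ
  /-- law of the features of one customer -/
  ctxLaw : Measure (Ctx K d)
  /-- it is a probability measure -/
  isProb : IsProbabilityMeasure ctxLaw

attribute [instance] Instance.isProb

namespace Instance

variable {K d : ℕ}

/-- The law of the customer feature `z`. -/
def zLaw (μ : Instance K d) : Measure (Fin d → ℝ) := μ.ctxLaw.map Prod.snd

/-- The law of `((x, z), g, ε)` for one customer: features, latent group and reward noise.
The group depends on the features through `z` only, and the noise is `N(0, σ²)` and independent
of everything else. -/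
def latentLaw (μ : Instance K d) (σ : ℝ≥0) : Measure (Ctx K d × Fin 2 × ℝ) :=
  μ.ctxLaw ⊗ₘ (((groupKernel μ.θ).comap Prod.snd measurable_snd) ×ₖ
    Kernel.const (Ctx K d) (gaussianReal 0 (σ ^ 2)))

/-- The expected reward `⟨x k, β g⟩` of arm `k` in group `g`. -/
def meanReward (μ : Instance K d) (x : Fin K → Fin d → ℝ) (g : Fin 2) (k : Fin K) : ℝ :=
  x k ⬝ᵥ μ.β g

end Instance

/-! ### Policies and the law of the interaction -/

/-- What is observed about one customer: features, chosen arm, received reward. -/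
abbrev Obs (K d : ℕ) : Type := Ctx K d × Fin K × ℝ

/-- The history of the first `n` customers. -/
abbrev Hist (K d n : ℕ) : Type := Fin n → Obs K d

/-- A (possibly randomized) policy: for each `n`, the conditional law of the arm offered to
customer `n` (counted from `0`), given the history of the previous `n` customers and the
features of the present one. -/
structure Policy (K d : ℕ) where
  /-- conditional law of the next arm -/
  act : ∀ n : ℕ, Kernel (Hist K d n × Ctx K d) (Fin K)
  /-- it is a probability measure -/
  isMarkov : ∀ n, IsMarkovKernel (act n)

attribute [instance] Policy.isMarkov

section Interaction

variable {K d : ℕ} (μ : Instance K d) (σ : ℝ≥0) (π : Policy K d)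

/-- Given the history of the first `n` customers: the conditional law of
`(((x, z), g, ε), a)` for the next customer. -/
def roundKernel (n : ℕ) : Kernel (Hist K d n) ((Ctx K d × Fin 2 × ℝ) × Fin K) :=
  Kernel.const (Hist K d n) (μ.latentLaw σ) ⊗ₖ
    (π.act n).comap (fun q : Hist K d n × (Ctx K d × Fin 2 × ℝ) => (q.1, q.2.1))
      (by fun_prop)

/-- The observation produced in one round: the reward is `⟨x a, β g⟩ + ε`. -/
def observe (w : (Ctx K d × Fin 2 × ℝ) × Fin K) : Obs K d :=
  (w.1.1, w.2, μ.meanReward w.1.1.1 w.1.2.1 w.2 + w.1.2.2)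

/-- The law of the history of the first `n` customers. -/
def histLaw : ∀ n : ℕ, Measure (Hist K d n)
  | 0 => Measure.dirac Fin.elim0
  | n + 1 => ((histLaw n) ⊗ₘ (roundKernel μ σ π n)).map
      fun q => Fin.snoc (α := fun _ => Obs K d) q.1 (observe μ q.2)

instance (μ : Instance K d) (σ : ℝ≥0) : IsProbabilityMeasure (μ.latentLaw σ) := by
  unfold Instance.latentLaw; infer_instance

instance (n : ℕ) : IsMarkovKernel (roundKernel μ σ π n) := by
  unfold roundKernel; infer_instance

theorem measurable_observe : Measurable (observe μ) := by
  have h : Measurable fun w : (Ctx K d × Fin 2 × ℝ) × Fin K =>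
      μ.meanReward w.1.1.1 w.1.2.1 w.2 := by
    have h2 : Measurable fun q : ((Fin K → Fin d → ℝ) × Fin 2) × Fin K =>
        μ.meanReward q.1.1 q.1.2 q.2 := by
      refine measurable_from_prod_countable_left fun k => ?_
      refine measurable_from_prod_countable_left fun g => ?_
      have hc : Continuous fun x : Fin K → Fin d → ℝ => x k ⬝ᵥ μ.β g :=
        Continuous.dotProduct (continuous_apply k) continuous_const
      exact hc.measurable
    exact h2.comp (by fun_prop :
      Measurable fun w : (Ctx K d × Fin 2 × ℝ) × Fin K => ((w.1.1.1, w.1.2.1), w.2))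
  exact (measurable_fst.comp measurable_fst).prodMk
    (measurable_snd.prodMk (h.add (by fun_prop)))

theorem measurable_snoc_observe (n : ℕ) :
    Measurable fun q : Hist K d n × ((Ctx K d × Fin 2 × ℝ) × Fin K) =>
      (Fin.snoc (α := fun _ => Obs K d) q.1 (observe μ q.2) : Hist K d (n + 1)) := by
  refine measurable_pi_lambda _ fun i => ?_
  refine Fin.lastCases ?_ (fun j => ?_) i
  · simp only [Fin.snoc_last]
    exact (measurable_observe μ).comp measurable_snd
  · simp only [Fin.snoc_castSucc]
    exact (measurable_pi_apply j).comp measurable_fst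

instance (n : ℕ) : IsProbabilityMeasure (histLaw μ σ π n) := by
  induction n with
  | zero => unfold histLaw; infer_instance
  | succ n ih =>
    unfold histLaw
    exact Measure.isProbabilityMeasure_map (measurable_snoc_observe μ n).aemeasurable

/-- The law of `(((x, z), g, ε), a)` for customer `n`. -/
def roundLaw (n : ℕ) : Measure ((Ctx K d × Fin 2 × ℝ) × Fin K) :=
  ((histLaw μ σ π n) ⊗ₘ (roundKernel μ σ π n)).map Prod.snd

end Interaction

/-! ### Oracles, regrets and misclassification error -/

/-- The maximizer of `v` (the least one, if there are several). -/
def argmax {K : ℕ} [NeZero K] (v : Fin K → ℝ) : Fin K :=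
  (Finset.univ.filter fun k => ∀ j, v j ≤ v k).min' (by
    obtain ⟨k, hk⟩ := Finite.exists_max v
    exact ⟨k, by simpa using hk⟩)

/-- The Bayes classifier: first group iff `p(zᵀθ) ≥ 1/2`. -/
def classify {d : ℕ} (θ z : Fin d → ℝ) : Fin 2 :=
  if 1 / 2 ≤ Real.sigmoid (z ⬝ᵥ θ) then 0 else 1

/-- The misclassification error `R(θ) = P(G(z; θ) ≠ g)` of the Bayes classifier, when `z` has law
`ν` and `g` follows the subgroup model with parameter `θ`. -/
def misclassError {d : ℕ} (θ : Fin d → ℝ) (ν : Measure (Fin d → ℝ)) : ℝ :=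
  (ν ⊗ₘ groupKernel θ).real {q | classify θ q.1 ≠ q.2}

section Regret

variable {K d : ℕ} [NeZero K] (μ : Instance K d) (σ : ℝ≥0) (π : Policy K d)

/-- Instant strong regret: comparison with the oracle that knows the realized group. -/
def instantStrong (w : (Ctx K d × Fin 2 × ℝ) × Fin K) : ℝ :=
  (⨆ k, μ.meanReward w.1.1.1 w.1.2.1 k) - μ.meanReward w.1.1.1 w.1.2.1 w.2

/-- The arm of the regular oracle, who knows the parameters but not the realized group. -/
def regularArm (c : Ctx K d) : Fin K :=
  argmax fun k => μ.meanReward c.1 (classify μ.θ c.2) k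

/-- Instant regular regret: comparison with the regular oracle. -/
def instantRegular (w : (Ctx K d × Fin 2 × ℝ) × Fin K) : ℝ :=
  μ.meanReward w.1.1.1 w.1.2.1 (regularArm μ w.1.1) - μ.meanReward w.1.1.1 w.1.2.1 w.2

/-- Expected cumulative strong regret over the first `T` customers. -/
def strongRegret (T : ℕ) : ℝ :=
  ∑ n ∈ Finset.range T, ∫ w, instantStrong μ w ∂(roundLaw μ σ π n)

/-- Expected cumulative regular regret over the first `T` customers. -/
def regularRegret (T : ℕ) : ℝ :=
  ∑ n ∈ Finset.range T, ∫ w, instantRegular μ w ∂(roundLaw μ σ π n)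

end Regret

/-! ### Assumptions and the class of instances -/

/-- `v` has at most `s` non-zero entries. -/
def IsSparse {d : ℕ} (s : ℕ) (v : Fin d → ℝ) : Prop :=
  (Finset.univ.filter fun j => v j ≠ 0).card ≤ s

/-- The random vector `X` is sub-Gaussian with constant `κ`: each one-dimensional marginal in a
direction of Euclidean length one has `ψ₂`-norm at most `κ`. The vector need not be centred. -/
def IsSubGaussian {Ω ι : Type*} [MeasurableSpace Ω] [Fintype ι] (P : Measure Ω)
    (X : Ω → ι → ℝ) (κ : ℝ) : Prop :=
  ∀ u : ι → ℝ, ∑ i, u i ^ 2 = 1 →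
    ∫⁻ ω, ENNReal.ofReal (Real.exp ((X ω ⬝ᵥ u) ^ 2 / κ ^ 2)) ∂P ≤ 2

/-- The second-moment matrix `E[X Xᵀ]`. -/
def secondMoment {Ω : Type*} [MeasurableSpace Ω] {d : ℕ} (P : Measure Ω)
    (X : Ω → Fin d → ℝ) : Matrix (Fin d) (Fin d) ℝ :=
  Matrix.of fun i j => ∫ ω, X ω i * X ω j ∂P

/-- `1/M < λ_min(S) ≤ λ_max(S) < M`: each eigenvalue of `S` lies strictly between `1/M` and
`M`. -/
def EigenvaluesWithin {d : ℕ} (M : ℝ) (S : Matrix (Fin d) (Fin d) ℝ) : Prop :=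
  ∀ l : ℝ, Module.End.HasEigenvalue (Matrix.toLin' S) l → 1 / M < l ∧ l < M

/-- The group probabilities are bounded away from `0` and `1`. -/
def NondegenerateGroups {d : ℕ} (ξ : ℝ) (θ : Fin d → ℝ) (ν : Measure (Fin d → ℝ)) : Prop :=
  ∀ᵐ z ∂ν, ξ < Real.sigmoid (z ⬝ᵥ θ) ∧ Real.sigmoid (z ⬝ᵥ θ) < 1 - ξ

/-- The class of instances with sparsity `s`, feature bound `xbar`, parameter bound `Lbar` and
constants `ξ`, `M`, `κ`, `C`, `hbar` of the remaining assumptions. -/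
structure InClass {K d : ℕ} [NeZero K] (s : ℕ) (xbar Lbar ξ M κ C hbar : ℝ)
    (μ : Instance K d) : Prop where
  sparse_theta : IsSparse s μ.θ
  sparse_beta : ∀ g, IsSparse s (μ.β g)
  beta_ne : μ.β 0 ≠ μ.β 1
  nondegenerate : NondegenerateGroups ξ μ.θ μ.zLaw
  /-- for each arm, the joint vector `(x k, z)` is sub-Gaussian -/
  subGaussian : ∀ k, IsSubGaussian μ.ctxLaw (fun c => Sum.elim (c.1 k) c.2) κ
  eigenvalues_x : ∀ k, EigenvaluesWithin M (secondMoment μ.ctxLaw fun c => c.1 k)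
  eigenvalues_z : EigenvaluesWithin M (secondMoment μ.zLaw id)
  bounded_x : ∀ᵐ c ∂μ.ctxLaw, ∀ k j, |c.1 k j| ≤ xbar
  bounded_beta : ∀ g, ∑ j, |μ.β g j| ≤ Lbar
  /-- margin condition: a runner-up of the best arm for group `g` comes within `h` of it with
  probability at most `C h` -/
  margin : ∀ g, ∀ h ∈ Set.Icc 0 hbar,
    μ.ctxLaw.real {c | ∃ k, k ≠ argmax (μ.meanReward c.1 g) ∧
      μ.meanReward c.1 g (argmax (μ.meanReward c.1 g)) ≤ μ.meanReward c.1 g k + h} ≤ C * h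

end LatentBandit

end

noncomputable section

namespace LatentBandit

section

/-! ### The Donsker-Varadhan inequality -/

/-! All hard instances make the reward model transparent and leave only the group to be guessed. One
random sign vector v generates every arm: arm 0 is v, arm 1 is -v, the others are v/2 (all times
`xbar`). The rewards of the two groups are opposite, `± Lbar` along one coordinate, and the arms are
independent of z. The mean reward is then `xbar * Lbar` times group sign, times the sign of v at
that coordinate, times the coefficient of the arm. Choosing an arm amounts to choosing a prediction
y in [-1, 1] of the group sign, and the optimal arm always leads by a fixed gap, so the margin event
is null.

Strong regret. The group is hidden, so given z the mean of (group sign) · y is at most |E[group sign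
| z]|. The mean of 1 - |E[group sign | z]| is twice the misclassification error (`misclassError_eq`,
`le_integral_instantStrong`).

Regular regret. Here θ is the only unknown. It ranges over vectors with one entry ±η in each of s
blocks of ⌊d/s⌋ coordinates; its length is δ = η√s. The feature z is a uniform sign vector
conditioned on |⟨z, θ⟩| ≤ b. The conditioning enforces nondegeneracy, and it costs only second-order
terms in δ, both in the regret and in the information. The regret of a round is at least a multiple
of E|⟨z, θ⟩| - E[⟨z, θ⟩ f(z)], where f is the mean prediction given the past. The first term is at
least δ/3. The second is ⟨w, θ⟩ with w_j = E[z_j f(z)], and Bessel's inequality gives |w| ≤ 1. So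
the policy must produce from its history a unit-ball vector correlated with θ
(`le_integral_instantRegular`).

That is impossible on average over the spikes. The history has relative entropy at most 4nδ²/b² with
respect to a common reference law with θ = 0 (`entropyBound_slabLaw`). Donsker–Varadhan, applied to
a truncated correlation, turns this into a bound on the mean of ⟨w, θ⟩
(`sum_integral_dotProduct_spikes_le`). Taking η² of order log(d/s)/T keeps the correlation below
δ/8, and summing δ over T rounds gives the rate.

Relative entropy enters only through the Donsker–Varadhan inequality itself (`EntropyBound`), whose
chain rule and data processing need neither densities nor absolute continuity. -/

theorem integrable_of_abs_le {α : Type*} [MeasurableSpace α] {P : Measure α} [IsFiniteMeasure P]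
    {F : α → ℝ} (hF : Measurable F) {C : ℝ} (hC : ∀ x, |F x| ≤ C) : Integrable F P :=
  Integrable.of_bound hF.aestronglyMeasurable C (ae_of_all _ fun x => by
    simpa [Real.norm_eq_abs] using hC x)

theorem abs_integral_le_of_abs_le {α : Type*} [MeasurableSpace α] {P : Measure α}
    [IsProbabilityMeasure P] {F : α → ℝ} {C : ℝ} (hC : ∀ x, |F x| ≤ C) :
    |∫ x, F x ∂P| ≤ C := by
  have h := norm_integral_le_of_norm_le_const (μ := P) (f := F) (C := C)
    (ae_of_all _ fun x => by simpa [Real.norm_eq_abs] using hC x)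
  simpa [Real.norm_eq_abs] using h

theorem integrable_exp_of_abs_le {α : Type*} [MeasurableSpace α] {P : Measure α}
    [IsFiniteMeasure P] {F : α → ℝ} (hF : Measurable F) {C : ℝ} (hC : ∀ x, |F x| ≤ C) :
    Integrable (fun x => Real.exp (F x)) P :=
  integrable_of_abs_le hF.exp (C := Real.exp C) fun x => by
    rw [abs_of_pos (Real.exp_pos _)]
    exact Real.exp_le_exp.2 ((abs_le.1 (hC x)).2)

theorem integral_exp_mem_Icc {α : Type*} [MeasurableSpace α] {P : Measure α}
    [IsProbabilityMeasure P] {F : α → ℝ} (hF : Measurable F) {C : ℝ} (hC : ∀ x, |F x| ≤ C) :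
    Real.exp (-C) ≤ ∫ x, Real.exp (F x) ∂P ∧ ∫ x, Real.exp (F x) ∂P ≤ Real.exp C := by
  have hi := integrable_exp_of_abs_le (P := P) hF hC
  constructor
  · have := integral_mono (μ := P) (integrable_const (Real.exp (-C))) hi
      fun x => Real.exp_le_exp.2 ((abs_le.1 (hC x)).1)
    simpa using this
  · have := integral_mono (μ := P) hi (integrable_const (Real.exp C))
      fun x => Real.exp_le_exp.2 ((abs_le.1 (hC x)).2)
    simpa using this

theorem integral_exp_pos_of_abs_le {α : Type*} [MeasurableSpace α] {P : Measure α}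
    [IsProbabilityMeasure P] {F : α → ℝ} (hF : Measurable F) {C : ℝ} (hC : ∀ x, |F x| ≤ C) :
    0 < ∫ x, Real.exp (F x) ∂P :=
  (Real.exp_pos _).trans_le (integral_exp_mem_Icc hF hC).1

/-- The conclusion of the Donsker-Varadhan inequality for measures whose relative entropy is at
most `k`. -/
def EntropyBound {α : Type*} [MeasurableSpace α] (P Q : Measure α) (k : ℝ) : Prop :=
  ∀ F : α → ℝ, Measurable F → (∃ C, ∀ x, |F x| ≤ C) →
    ∫ x, F x ∂P ≤ k + Real.log (∫ x, Real.exp (F x) ∂Q)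

namespace EntropyBound

variable {α β : Type*} [MeasurableSpace α] [MeasurableSpace β]

/-- Jensen's inequality, from e^y ≥ 1 + y at y = F - log E[e^F]. -/
theorem refl (P : Measure α) [IsProbabilityMeasure P] : EntropyBound P P 0 := by
  rintro F hF ⟨C, hC⟩
  set I := ∫ x, Real.exp (F x) ∂P with hI
  have hpos : 0 < I := integral_exp_pos_of_abs_le hF hC
  have hint := integrable_exp_of_abs_le (P := P) hF hC
  have h : ∫ x, (F x - Real.log I) ∂P ≤ ∫ x, (Real.exp (F x) / I - 1) ∂P := by
    refine integral_mono ((integrable_of_abs_le hF hC).sub (integrable_const _))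
      ((hint.div_const _).sub (integrable_const _)) fun x => ?_
    have := Real.add_one_le_exp (F x - Real.log I)
    rw [Real.exp_sub, Real.exp_log hpos] at this
    dsimp only
    linarith
  rw [integral_sub (integrable_of_abs_le hF hC) (integrable_const _),
    integral_sub (hint.div_const _) (integrable_const _), integral_div, ← hI, div_self hpos.ne']
    at h
  simp only [integral_const, probReal_univ, smul_eq_mul, one_mul] at h
  linarith

theorem mono {P Q : Measure α} {k k' : ℝ} (h : EntropyBound P Q k) (hk : k ≤ k') :
    EntropyBound P Q k' := fun F hF hb => (h F hF hb).trans (by linarith)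

theorem map {P Q : Measure α} {k : ℝ} (h : EntropyBound P Q k) {f : α → β} (hf : Measurable f) :
    EntropyBound (P.map f) (Q.map f) k := by
  rintro F hF ⟨C, hC⟩
  rw [integral_map hf.aemeasurable hF.aestronglyMeasurable,
    integral_map hf.aemeasurable hF.exp.aestronglyMeasurable]
  exact h (fun x => F (f x)) (hF.comp hf) ⟨C, fun x => hC _⟩

/-- The chain rule for relative entropy. The conditional log-partition function `F'` of F is itself
a bounded test function, to which the bound for the first marginals applies. -/
theorem compProd {P Q : Measure α} [IsProbabilityMeasure P] [IsProbabilityMeasure Q]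
    {κ η : Kernel α β} [IsMarkovKernel κ] [IsMarkovKernel η] {k : ℝ} {l : α → ℝ}
    (h : EntropyBound P Q k) (hκ : ∀ a, EntropyBound (κ a) (η a) (l a)) (hl : Integrable l P) :
    EntropyBound (P ⊗ₘ κ) (Q ⊗ₘ η) (k + ∫ a, l a ∂P) := by
  rintro F hF ⟨C, hC⟩
  have hm : ∀ a, Measurable fun b => F (a, b) := fun a => hF.comp measurable_prodMk_left
  set F' : α → ℝ := fun a => Real.log (∫ b, Real.exp (F (a, b)) ∂η a) with hF'
  have hmem : ∀ a, Real.exp (-C) ≤ ∫ b, Real.exp (F (a, b)) ∂η a ∧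
      ∫ b, Real.exp (F (a, b)) ∂η a ≤ Real.exp C := fun a =>
    integral_exp_mem_Icc (hm a) fun b => hC (a, b)
  have hpos : ∀ a, 0 < ∫ b, Real.exp (F (a, b)) ∂η a := fun a => (Real.exp_pos _).trans_le (hmem a).1
  have hFC : ∀ a, |F' a| ≤ C := fun a => abs_le.2
    ⟨(Real.le_log_iff_exp_le (hpos a)).2 (hmem a).1, (Real.log_le_iff_le_exp (hpos a)).2 (hmem a).2⟩
  have hFm : Measurable F' :=
    ((hF.exp.stronglyMeasurable).integral_kernel_prod_right').measurable.log
  have hexp : ∫ x, Real.exp (F x) ∂(Q ⊗ₘ η) = ∫ a, Real.exp (F' a) ∂Q := by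
    rw [Measure.integral_compProd (integrable_exp_of_abs_le hF hC)]
    exact integral_congr_ae (ae_of_all _ fun a => (Real.exp_log (hpos a)).symm)
  rw [hexp, Measure.integral_compProd (integrable_of_abs_le hF hC)]
  have h1 : ∫ a, ∫ b, F (a, b) ∂κ a ∂P ≤ ∫ a, (l a + F' a) ∂P := by
    refine integral_mono ?_ (hl.add (integrable_of_abs_le hFm hFC)) fun a =>
      hκ a _ (hm a) ⟨C, fun b => hC _⟩
    exact integrable_of_abs_le
      ((hF.stronglyMeasurable).integral_kernel_prod_right').measurable
      fun a => abs_integral_le_of_abs_le fun b => hC (a, b)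
  rw [integral_add hl (integrable_of_abs_le hFm hFC)] at h1
  have h2 := h F' hFm ⟨C, hFC⟩
  linarith

theorem prod {P Q : Measure α} [IsProbabilityMeasure P] [IsProbabilityMeasure Q]
    {P' Q' : Measure β} [IsProbabilityMeasure P'] [IsProbabilityMeasure Q'] {k k' : ℝ}
    (h : EntropyBound P Q k) (h' : EntropyBound P' Q' k') :
    EntropyBound (P.prod P') (Q.prod Q') (k + k') := by
  have := h.compProd (κ := Kernel.const α P') (η := Kernel.const α Q') (l := fun _ => k')
    (fun a => by simpa using h') (integrable_const _)
  simpa [Measure.compProd_const] using this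

/-- Conditioning on an event of probability `q` costs `-log q`. -/
theorem cond (P : Measure α) [IsProbabilityMeasure P] {S : Set α} (hS : P S ≠ 0) :
    EntropyBound P[|S] P (-Real.log (P.real S)) := by
  rintro F hF ⟨C, hC⟩
  have : IsProbabilityMeasure P[|S] := cond_isProbabilityMeasure hS
  have h1 := refl P[|S] F hF ⟨C, hC⟩
  have hq : 0 < P.real S := by
    rw [measureReal_def]; exact ENNReal.toReal_pos hS (measure_ne_top _ _)
  -- The conditional law has density at most 1/P(S), which is the whole cost.
  have h2 : ∫ x, Real.exp (F x) ∂P[|S] ≤ (P.real S)⁻¹ * ∫ x, Real.exp (F x) ∂P := by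
    rw [ProbabilityTheory.cond, integral_smul_measure, ENNReal.toReal_inv, smul_eq_mul]
    refine mul_le_mul_of_nonneg_left ?_ (inv_nonneg.2 hq.le)
    exact setIntegral_le_integral (integrable_exp_of_abs_le hF hC)
      (ae_of_all _ fun x => (Real.exp_pos _).le)
  have hp := integral_exp_pos_of_abs_le (P := P[|S]) hF hC
  have hp' := integral_exp_pos_of_abs_le (P := P) hF hC
  have h3 := Real.log_le_log hp h2
  rw [Real.log_mul (inv_ne_zero hq.ne') hp'.ne', Real.log_inv] at h3
  linarith

/-- Averaging over a finite family: if the average of `exp F` is everywhere at most `exp c`, then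
the average of the means of `F` is at most `k + c`. -/
theorem sum_le {Ω : Type*} [Fintype Ω] [Nonempty Ω] {P : Ω → Measure α} {Q : Measure α}
    [∀ ω, IsProbabilityMeasure (P ω)]
    [IsProbabilityMeasure Q] {k c : ℝ} (h : ∀ ω, EntropyBound (P ω) Q k) {F : Ω → α → ℝ}
    (hF : ∀ ω, Measurable (F ω)) {C : ℝ} (hC : ∀ ω x, |F ω x| ≤ C)
    (hc : ∀ x, ∑ ω, Real.exp (F ω x) ≤ Fintype.card Ω * Real.exp c) :
    ∑ ω, ∫ x, F ω x ∂(P ω) ≤ Fintype.card Ω * (k + c) := by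
  -- The bound log x ≤ x - 1 linearizes the logarithm at `exp c`. After that the sum over ω passes
  -- under the integral against the common Q.
  have h1 : ∀ ω, ∫ x, F ω x ∂(P ω) ≤ k + c + ((∫ x, Real.exp (F ω x) ∂Q) / Real.exp c - 1) := by
    intro ω
    have hp := integral_exp_pos_of_abs_le (P := Q) (hF ω) (hC ω)
    have h2 := h ω (F ω) (hF ω) ⟨C, hC ω⟩
    have h3 := Real.log_le_sub_one_of_pos (div_pos hp (Real.exp_pos c))
    rw [Real.log_div hp.ne' (Real.exp_pos c).ne', Real.log_exp] at h3
    linarith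
  have h4 : ∑ ω, ∫ x, Real.exp (F ω x) ∂Q ≤ Fintype.card Ω * Real.exp c := by
    rw [← integral_finsetSum _ fun ω _ => integrable_exp_of_abs_le (hF ω) (hC ω)]
    have := integral_mono (μ := Q)
      (integrable_finsetSum _ fun ω _ => integrable_exp_of_abs_le (hF ω) (hC ω))
      (integrable_const _) hc
    simpa using this
  calc ∑ ω, ∫ x, F ω x ∂(P ω)
      ≤ ∑ ω, (k + c + ((∫ x, Real.exp (F ω x) ∂Q) / Real.exp c - 1)) :=
        Finset.sum_le_sum fun ω _ => h1 ω
    _ = Fintype.card Ω * (k + c)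
        + ((∑ ω, ∫ x, Real.exp (F ω x) ∂Q) / Real.exp c - Fintype.card Ω) := by
        simp only [Finset.sum_add_distrib, Finset.sum_sub_distrib, Finset.sum_const,
          Finset.card_univ, nsmul_eq_mul, Finset.sum_div]
        ring
    _ ≤ _ := by
        have := (div_le_iff₀ (Real.exp_pos c)).2 h4
        linarith

end EntropyBound

/-! ### The subgroup model -/

theorem integral_groupKernel {d : ℕ} (θ z : Fin d → ℝ) (f : Fin 2 → ℝ) :
    ∫ g, f g ∂groupKernel θ z =
      Real.sigmoid (z ⬝ᵥ θ) * f 0 + (1 - Real.sigmoid (z ⬝ᵥ θ)) * f 1 := by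
  change ∫ g, f g ∂(ENNReal.ofReal (Real.sigmoid (z ⬝ᵥ θ)) • Measure.dirac (0 : Fin 2) +
      ENNReal.ofReal (1 - Real.sigmoid (z ⬝ᵥ θ)) • Measure.dirac (1 : Fin 2)) = _
  rw [integral_add_measure, integral_smul_measure, integral_smul_measure, integral_dirac,
    integral_dirac, ENNReal.toReal_ofReal (Real.sigmoid_nonneg _),
    ENNReal.toReal_ofReal (sub_nonneg.2 (Real.sigmoid_le_one _))]
  · simp
  · exact (Integrable.of_finite).smul_measure (by simp)
  · exact (Integrable.of_finite).smul_measure (by simp)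

/-- The mean of the group sign (`1` for the first group, `-1` for the second). -/
def groupBias (u : ℝ) : ℝ := 2 * Real.sigmoid u - 1

theorem continuous_groupBias : Continuous groupBias :=
  (continuous_const.mul continuous_sigmoid).sub continuous_const

theorem abs_groupBias_le_one (u : ℝ) : |groupBias u| ≤ 1 := by
  unfold groupBias
  rw [abs_le]
  constructor <;> linarith [Real.sigmoid_nonneg u, Real.sigmoid_le_one u]

theorem groupBias_neg (u : ℝ) : groupBias (-u) = -groupBias u := by
  unfold groupBias
  rw [Real.sigmoid_neg]; ring

theorem groupBias_eq_div (u : ℝ) : groupBias u = (1 - Real.exp (-u)) / (1 + Real.exp (-u)) := by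
  unfold groupBias
  have h := Real.exp_pos (-u)
  rw [Real.sigmoid_def, eq_div_iff (by positivity)]
  field_simp
  ring

theorem groupBias_nonneg {u : ℝ} (hu : 0 ≤ u) : 0 ≤ groupBias u := by
  rw [groupBias_eq_div]
  have h := Real.exp_pos (-u)
  have : Real.exp (-u) ≤ 1 := Real.exp_le_one_iff.2 (by linarith)
  exact div_nonneg (by linarith) (by linarith)

theorem abs_groupBias_le (u : ℝ) : |groupBias u| ≤ |u| := by
  wlog hu : 0 ≤ u generalizing u
  · have := this (-u) (by linarith)
    rwa [groupBias_neg, abs_neg, abs_neg] at this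
  rw [abs_of_nonneg (groupBias_nonneg hu), abs_of_nonneg hu, groupBias_eq_div]
  have h := Real.exp_pos (-u)
  rw [div_le_iff₀ (by positivity)]
  nlinarith [Real.add_one_le_exp (-u)]

/-- From (1 - u/2)(1 + u) ≥ 1 on [0, 1] one gets e^{-u} ≤ 1 - u/2. So the numerator of the bias is
at least u/2, and its denominator is at most 2. -/
theorem div_four_le_groupBias {u : ℝ} (hu : 0 ≤ u) (hu1 : u ≤ 1) : u / 4 ≤ groupBias u := by
  rw [groupBias_eq_div]
  have h := Real.exp_pos (-u)
  have h1 : Real.exp (-u) ≤ 1 - u / 2 := by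
    rw [Real.exp_neg, inv_le_comm₀ (Real.exp_pos _) (by linarith)]
    refine le_trans ?_ (Real.add_one_le_exp u)
    rw [inv_le_iff_one_le_mul₀ (by linarith)]
    nlinarith
  rw [le_div_iff₀ (by positivity)]
  nlinarith

/-- For `|u| ≤ 1` and `|y| ≤ 1`, the cost of predicting the group sign by `y` is at least a multiple
of the distance of `u` from the decision boundary. -/
theorem abs_sub_mul_le_groupBias {u y : ℝ} (hu : |u| ≤ 1) (hy : |y| ≤ 1) :
    (|u| - u * y) / 4 ≤ |groupBias u| - groupBias u * y := by
  wlog h0 : 0 ≤ u generalizing u y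
  · have := @this (-u) (-y) (by simpa using hu) (by simpa using hy) (by linarith)
    simpa [groupBias_neg] using this
  rw [abs_of_nonneg h0, abs_of_nonneg (groupBias_nonneg h0)]
  rw [abs_of_nonneg h0] at hu
  have h1 := div_four_le_groupBias h0 hu
  nlinarith [(abs_le.1 hy).2]

theorem sigmoid_zero_eq : Real.sigmoid 0 = 1 / 2 := by
  rw [Real.sigmoid_def]; norm_num

/-- The relative entropy of a biased coin with respect to a fair one is at most its χ²-divergence
(2p - 1)², and the bias 2p - 1 is at most |⟨z, θ⟩| in absolute value. -/
theorem entropyBound_groupKernel {d : ℕ} (θ z : Fin d → ℝ) :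
    EntropyBound (groupKernel θ z) (groupKernel 0 z) ((z ⬝ᵥ θ) ^ 2) := by
  rintro F - -
  simp only [integral_groupKernel, dotProduct_zero, sigmoid_zero_eq]
  set p := Real.sigmoid (z ⬝ᵥ θ) with hp
  have hp0 : 0 < p := Real.sigmoid_pos _
  have hp1 : 0 < 1 - p := sub_pos.2 (Real.sigmoid_lt_one _)
  set I := 1 / 2 * Real.exp (F 0) + (1 - 1 / 2) * Real.exp (F 1) with hI
  have hIpos : 0 < I := by
    have := Real.exp_pos (F 0)
    have := Real.exp_pos (F 1)
    rw [hI]; linarith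
  -- The contribution of one outcome of probability r under the biased coin and 1/2 under the fair
  -- one. The terms r(2r - 1) for r = p and r = 1 - p add up to (2p - 1)².
  have key : ∀ (r f : ℝ), 0 < r →
      r * f ≤ r * (2 * r - 1) + r * Real.log I + (Real.exp f / I / 2 - r) := by
    intro r f hr
    have h1 := Real.add_one_le_exp (f - Real.log (2 * r) - Real.log I)
    rw [Real.exp_sub, Real.exp_sub, Real.exp_log hIpos, Real.exp_log (by linarith)] at h1
    have h2 := Real.log_le_sub_one_of_pos (show 0 < 2 * r by linarith)
    have h3 : f ≤ (2 * r - 1) + Real.log I + (Real.exp f / (2 * r) / I - 1) := by linarith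
    have h4 := mul_le_mul_of_nonneg_left h3 hr.le
    refine h4.trans (le_of_eq ?_)
    field_simp
  have h0 := key p (F 0) hp0
  have h1 := key (1 - p) (F 1) hp1
  have hs : Real.exp (F 0) / I / 2 + Real.exp (F 1) / I / 2 = 1 := by
    field_simp
    rw [hI]; ring
  have hb : groupBias (z ⬝ᵥ θ) ^ 2 ≤ (z ⬝ᵥ θ) ^ 2 := sq_le_sq.2 (abs_groupBias_le _)
  have hb' : groupBias (z ⬝ᵥ θ) = 2 * p - 1 := rfl
  rw [hb'] at hb
  nlinarith

end

section

/-! ### Vectors of independent random signs -/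

/-- The law of a fair random sign. -/
def rademacher : Measure ℝ :=
  (2⁻¹ : ENNReal) • Measure.dirac 1 + (2⁻¹ : ENNReal) • Measure.dirac (-1)

instance : IsProbabilityMeasure rademacher := ⟨by
  simp [rademacher, ENNReal.inv_two_add_inv_two]⟩

theorem ae_rademacher {p : ℝ → Prop} (h1 : p 1) (h2 : p (-1)) : ∀ᵐ r ∂rademacher, p r := by
  have h : MeasurableSet ({1, -1} : Set ℝ) := (Set.finite_singleton _).measurableSet.insert _
  have : ∀ᵐ r ∂rademacher, r ∈ ({1, -1} : Set ℝ) := by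
    rw [ae_iff]
    change rademacher ({1, -1} : Set ℝ)ᶜ = 0
    simp [rademacher, h.compl]
  filter_upwards [this] with r hr
  rcases hr with rfl | rfl
  exacts [h1, h2]

theorem integral_rademacher (f : ℝ → ℝ) : ∫ r, f r ∂rademacher = (f 1 + f (-1)) / 2 := by
  have hi : ∀ a : ℝ, Integrable f (Measure.dirac a) := fun a => integrable_dirac (by simp)
  rw [rademacher, integral_add_measure ((hi _).smul_measure (by simp))
    ((hi _).smul_measure (by simp)), integral_smul_measure, integral_smul_measure,
    integral_dirac, integral_dirac]
  simp
  ring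

/-- The law of a vector of `d` independent fair signs. -/
def signLaw (d : ℕ) : Measure (Fin d → ℝ) := Measure.pi fun _ => rademacher

variable {d : ℕ}

instance : IsProbabilityMeasure (signLaw d) := by unfold signLaw; infer_instance

theorem ae_signLaw : ∀ᵐ r ∂signLaw d, ∀ j, r j = 1 ∨ r j = -1 := by
  rw [ae_all_iff]
  intro j
  have h := (measurePreserving_eval (fun _ : Fin d => rademacher) j).quasiMeasurePreserving
  exact h.ae (ae_rademacher (p := fun r => r = 1 ∨ r = -1) (Or.inl rfl) (Or.inr rfl))

theorem ae_signLaw_abs : ∀ᵐ r ∂signLaw d, ∀ j, |r j| = 1 := by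
  filter_upwards [ae_signLaw] with r hr j
  rcases hr j with h | h <;> simp [h]

theorem integrable_signLaw {f : (Fin d → ℝ) → ℝ} (hf : Continuous f) :
    Integrable f (signLaw d) := by
  obtain ⟨C, hC⟩ := (isCompact_Icc (a := fun _ : Fin d => (-1 : ℝ)) (b := fun _ => 1)).exists_bound_of_continuousOn
    hf.continuousOn
  refine Integrable.of_bound hf.aestronglyMeasurable C ?_
  filter_upwards [ae_signLaw_abs] with r hr
  refine hC r ⟨fun j => ?_, fun j => ?_⟩
  · exact (abs_le.1 (hr j).le).1
  · exact (abs_le.1 (hr j).le).2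

theorem integral_signLaw_mul (i j : Fin d) :
    ∫ r, r i * r j ∂signLaw d = if i = j then 1 else 0 := by
  split_ifs with h
  · subst h
    rw [integral_congr_ae (g := fun _ => (1 : ℝ))]
    · simp
    · filter_upwards [ae_signLaw_abs] with r hr
      rw [← abs_mul_abs_self, hr i, one_mul]
  · have hind : IndepFun (fun r : Fin d → ℝ => r i) (fun r => r j) (signLaw d) :=
      (iIndepFun_pi (μ := fun _ : Fin d => rademacher) (X := fun _ => id)
        fun _ => aemeasurable_id).indepFun h
    rw [hind.integral_fun_mul_eq_mul_integral (measurable_pi_apply i).aestronglyMeasurable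
      (measurable_pi_apply j).aestronglyMeasurable]
    have h0 : ∫ r, r i ∂signLaw d = 0 := by
      have := integral_comp_eval (μ := fun _ : Fin d => rademacher) (i := i) (f := id)
        (by fun_prop)
      simp only [id] at this
      rw [signLaw, this, integral_rademacher]
      simp
    rw [h0, zero_mul]

theorem integral_signLaw_exp (u : Fin d → ℝ) :
    ∫ r, Real.exp (r ⬝ᵥ u) ∂signLaw d = ∏ i, Real.cosh (u i) := by
  have : ∀ r : Fin d → ℝ, Real.exp (r ⬝ᵥ u) = ∏ i, Real.exp (r i * u i) := fun r => by
    rw [dotProduct, Real.exp_sum]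
  simp only [this]
  rw [signLaw, integral_fintype_prod_eq_prod (fun i x => Real.exp (x * u i))]
  refine Finset.prod_congr rfl fun i _ => ?_
  rw [integral_rademacher, Real.cosh_eq]
  simp

theorem continuous_dotProduct_left (u : Fin d → ℝ) : Continuous fun r : Fin d → ℝ => r ⬝ᵥ u :=
  Continuous.dotProduct continuous_id continuous_const

theorem integral_signLaw_sq (u : Fin d → ℝ) :
    ∫ r, (r ⬝ᵥ u) ^ 2 ∂signLaw d = ∑ i, u i ^ 2 := by
  have h : ∀ r : Fin d → ℝ, (r ⬝ᵥ u) ^ 2 = ∑ i, ∑ j, (u i * u j) * (r i * r j) := fun r => by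
    rw [sq, dotProduct, Finset.sum_mul_sum]
    exact Finset.sum_congr rfl fun i _ => Finset.sum_congr rfl fun j _ => by ring
  simp only [h]
  rw [integral_finsetSum _ fun i _ => integrable_finsetSum _ fun j _ =>
    integrable_signLaw (by fun_prop)]
  refine Finset.sum_congr rfl fun i _ => ?_
  rw [integral_finsetSum _ fun j _ => integrable_signLaw (by fun_prop)]
  simp only [integral_const_mul, integral_signLaw_mul]
  simp [sq]

theorem lintegral_exp_sq_gaussianReal :
    ∫⁻ g, ENNReal.ofReal (Real.exp (g ^ 2 / 4)) ∂gaussianReal 0 1 = ENNReal.ofReal (√2) := by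
  rw [gaussianReal_of_var_ne_zero _ one_ne_zero,
    lintegral_withDensity_eq_lintegral_mul _ (measurable_gaussianPDF _ _) (by fun_prop)]
  have h : ∀ g : ℝ, (gaussianPDF 0 1 * fun g => ENNReal.ofReal (Real.exp (g ^ 2 / 4))) g =
      ENNReal.ofReal ((√(2 * Real.pi))⁻¹ * Real.exp (-(1 / 4) * g ^ 2)) := fun g => by
    rw [Pi.mul_apply, gaussianPDF, ← ENNReal.ofReal_mul (gaussianPDFReal_nonneg _ _ _),
      gaussianPDFReal]
    congr 1
    rw [mul_assoc, ← Real.exp_add]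
    congr 2
    · simp
    · simp; ring
  simp only [h]
  rw [← ofReal_integral_eq_lintegral_ofReal
    ((integrable_exp_neg_mul_sq (by norm_num)).const_mul _) (ae_of_all _ fun g => by positivity),
    integral_const_mul, integral_gaussian]
  congr 1
  rw [← Real.sqrt_inv, ← Real.sqrt_mul (by positivity)]
  congr 1
  field_simp
  norm_num

/-- Gaussian linearization: e^{y²/4} is the mean of e^{yg/√2} over a standard normal g. After
exchanging the integrals the signs factor into cosh terms, each at most a Gaussian exponential, and
what remains is at most E e^{g²/4} = √2. -/
theorem lintegral_signLaw_exp_sq_le {u : Fin d → ℝ} (hu : ∑ i, u i ^ 2 ≤ 1) :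
    ∫⁻ r, ENNReal.ofReal (Real.exp ((r ⬝ᵥ u) ^ 2 / 4)) ∂signLaw d ≤ ENNReal.ofReal (√2) := by
  have h2 : (√2) ^ 2 = 2 := Real.sq_sqrt (by norm_num)
  have h20 : 0 < √2 := by positivity
  have h1 : ∀ y : ℝ, ENNReal.ofReal (Real.exp (y ^ 2 / 4)) =
      ∫⁻ g, ENNReal.ofReal (Real.exp (y / √2 * g)) ∂gaussianReal 0 1 := fun y => by
    rw [← ofReal_integral_eq_lintegral_ofReal (integrable_exp_mul_gaussianReal _)
      (ae_of_all _ fun g => (Real.exp_pos _).le)]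
    have := congrFun (mgf_id_gaussianReal (μ := 0) (v := 1)) (y / √2)
    rw [mgf] at this
    simp only [id] at this
    rw [this]
    congr 2
    rw [div_pow, h2]
    simp; ring
  simp only [h1]
  have hc : Continuous fun p : (Fin d → ℝ) × ℝ => Real.exp (p.1 ⬝ᵥ u / √2 * p.2) := by
    have := continuous_dotProduct_left u
    fun_prop
  rw [lintegral_lintegral_swap hc.measurable.ennreal_ofReal.aemeasurable]
  refine (lintegral_mono fun g => ?_).trans lintegral_exp_sq_gaussianReal.le
  have h3 : ∀ r : Fin d → ℝ, r ⬝ᵥ u / √2 * g = r ⬝ᵥ (fun i => u i / √2 * g) := fun r => by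
    simp only [dotProduct, Finset.sum_div, Finset.sum_mul]
    exact Finset.sum_congr rfl fun i _ => by ring
  simp only [h3]
  have hc3 := continuous_dotProduct_left fun i => u i / √2 * g
  rw [← ofReal_integral_eq_lintegral_ofReal (integrable_signLaw (by fun_prop))
      (ae_of_all _ fun g => (Real.exp_pos _).le), integral_signLaw_exp]
  refine ENNReal.ofReal_le_ofReal ?_
  calc ∏ i, Real.cosh (u i / √2 * g) ≤ ∏ i, Real.exp ((u i / √2 * g) ^ 2 / 2) :=
        Finset.prod_le_prod (fun i _ => (Real.cosh_pos _).le) fun i _ =>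
          Real.cosh_le_exp_half_sq _
    _ = Real.exp ((∑ i, u i ^ 2) * (g ^ 2 / 4)) := by
        rw [← Real.exp_sum, Finset.sum_mul]
        congr 1
        refine Finset.sum_congr rfl fun i _ => ?_
        rw [mul_pow, div_pow, h2]; ring
    _ ≤ _ := Real.exp_le_exp.2 (by nlinarith [sq_nonneg g])

theorem integral_signLaw_exp_sq_le {u : Fin d → ℝ} (hu : ∑ i, u i ^ 2 ≤ 1) :
    ∫ r, Real.exp ((r ⬝ᵥ u) ^ 2 / 4) ∂signLaw d ≤ √2 := by
  have h := lintegral_signLaw_exp_sq_le hu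
  have hc := continuous_dotProduct_left u
  rw [← ofReal_integral_eq_lintegral_ofReal (integrable_signLaw (by fun_prop))
      (ae_of_all _ fun g => (Real.exp_pos _).le)] at h
  exact (ENNReal.ofReal_le_ofReal_iff (by positivity)).1 h

/-- Since e^x ≥ 1 + x + x²/2 at x = y²/4, y⁴ ≤ 32 e^{y²/4} - 32 - 8y². The mean of the right side is
at most 32√2 - 40, and 1.4375 = 46/32 is the bound on √2 that makes this 6. -/
theorem integral_signLaw_pow_four_le {u : Fin d → ℝ} (hu : ∑ i, u i ^ 2 = 1) :
    ∫ r, (r ⬝ᵥ u) ^ 4 ∂signLaw d ≤ 6 := by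
  have hc := continuous_dotProduct_left u
  have h1 : ∫ r, (r ⬝ᵥ u) ^ 4 ∂signLaw d ≤
      ∫ r, (32 * Real.exp ((r ⬝ᵥ u) ^ 2 / 4) - 32 - 8 * (r ⬝ᵥ u) ^ 2) ∂signLaw d := by
    refine integral_mono (integrable_signLaw (by fun_prop)) (integrable_signLaw (by fun_prop))
      fun r => ?_
    have := Real.quadratic_le_exp_of_nonneg (x := (r ⬝ᵥ u) ^ 2 / 4) (by positivity)
    dsimp only
    nlinarith
  rw [integral_sub (integrable_signLaw (by fun_prop)) (integrable_signLaw (by fun_prop)),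
    integral_sub (integrable_signLaw (by fun_prop)) (integrable_signLaw (by fun_prop)),
    integral_const_mul, integral_const_mul, integral_signLaw_sq, hu] at h1
  have h2 := integral_signLaw_exp_sq_le hu.le
  have h3 : √2 ≤ 1.4375 := by rw [Real.sqrt_le_left (by norm_num)]; norm_num
  simp only [integral_const, probReal_univ, smul_eq_mul, one_mul] at h1
  linarith

/-- For y ≥ 0 one has y ≥ y²/2 - y⁴/54, because the difference is y(y - 3)²(y + 6)/54. With second
moment 1 and fourth moment at most 6 this leaves 1/2 - 1/9. -/
theorem third_le_integral_signLaw_abs {u : Fin d → ℝ} (hu : ∑ i, u i ^ 2 = 1) :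
    1 / 3 ≤ ∫ r, |r ⬝ᵥ u| ∂signLaw d := by
  have hc := continuous_dotProduct_left u
  have h1 : ∫ r, (1 / 2 * (r ⬝ᵥ u) ^ 2 - 1 / 54 * (r ⬝ᵥ u) ^ 4) ∂signLaw d ≤
      ∫ r, |r ⬝ᵥ u| ∂signLaw d := by
    refine integral_mono (integrable_signLaw (by fun_prop)) (integrable_signLaw (by fun_prop))
      fun r => ?_
    dsimp only
    rw [← sq_abs, show (r ⬝ᵥ u) ^ 4 = |r ⬝ᵥ u| ^ 4 by rw [Even.pow_abs ⟨2, rfl⟩]]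
    have h0 := abs_nonneg (r ⬝ᵥ u)
    set y := |r ⬝ᵥ u|
    nlinarith [mul_nonneg h0 (mul_nonneg (sq_nonneg (y - 3)) (add_nonneg h0 (by norm_num : (0:ℝ) ≤ 6)))]
  rw [integral_sub (integrable_signLaw (by fun_prop)) (integrable_signLaw (by fun_prop)),
    integral_const_mul, integral_const_mul, integral_signLaw_sq, hu] at h1
  linarith [integral_signLaw_pow_four_le hu]

theorem exists_smul_eq {u : Fin d → ℝ} {δ : ℝ} (hδ : 0 < δ) (hu : ∑ i, u i ^ 2 = δ ^ 2) :
    ∃ v : Fin d → ℝ, ∑ i, v i ^ 2 = 1 ∧ u = δ • v := by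
  refine ⟨δ⁻¹ • u, ?_, ?_⟩
  · simp only [Pi.smul_apply, smul_eq_mul, mul_pow, ← Finset.mul_sum, hu]
    field_simp
  · rw [smul_smul, mul_inv_cancel₀ hδ.ne', one_smul]

theorem div_three_le_integral_signLaw_abs {u : Fin d → ℝ} {δ : ℝ} (hδ : 0 < δ)
    (hu : ∑ i, u i ^ 2 = δ ^ 2) : δ / 3 ≤ ∫ r, |r ⬝ᵥ u| ∂signLaw d := by
  obtain ⟨v, hv, rfl⟩ := exists_smul_eq hδ hu
  simp only [dotProduct_smul, smul_eq_mul, abs_mul, abs_of_pos hδ, integral_const_mul]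
  nlinarith [third_le_integral_signLaw_abs hv]

/-- Bessel's inequality for the coordinates of a random sign vector. -/
theorem sum_integral_mul_sq_le {f : (Fin d → ℝ) → ℝ} (hf : Measurable f) (h1 : ∀ r, |f r| ≤ 1) :
    ∑ j, (∫ r, r j * f r ∂signLaw d) ^ 2 ≤ 1 := by
  set m : Fin d → ℝ := fun j => ∫ r, r j * f r ∂signLaw d with hm
  have hfi : Integrable f (signLaw d) := integrable_of_abs_le hf h1
  have hif : ∀ g : (Fin d → ℝ) → ℝ, Continuous g → Integrable (fun r => g r * f r) (signLaw d) :=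
    fun g hg => (integrable_signLaw hg).mul_bdd (c := 1) hf.aestronglyMeasurable
      (ae_of_all _ fun r => by simpa [Real.norm_eq_abs] using h1 r)
  have hc := continuous_dotProduct_left m
  have h2 : ∫ r, (r ⬝ᵥ m) * f r ∂signLaw d = ∑ j, m j ^ 2 := by
    simp only [dotProduct, Finset.sum_mul]
    rw [integral_finsetSum _ fun j _ => hif (fun r => r j * m j) (by fun_prop)]
    refine Finset.sum_congr rfl fun j _ => ?_
    rw [sq, hm]
    simp only
    rw [← integral_mul_const]
    exact integral_congr_ae (ae_of_all _ fun r => by dsimp only; ring)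
  -- This is (⟨r, m⟩ - f)² ≥ 0 with f² ≤ 1; both mixed and square terms integrate to |m|².
  have h3 : ∫ r, (2 * ((r ⬝ᵥ m) * f r) - (r ⬝ᵥ m) ^ 2) ∂signLaw d ≤ ∫ r, (1 : ℝ) ∂signLaw d := by
    refine integral_mono (((hif _ hc).const_mul 2).sub (integrable_signLaw (by fun_prop)))
      (integrable_const _) fun r => ?_
    have : f r ^ 2 ≤ 1 := by rw [sq_le_one_iff_abs_le_one]; exact h1 r
    dsimp only
    nlinarith [sq_nonneg (r ⬝ᵥ m - f r)]
  rw [integral_sub ((hif _ hc).const_mul 2) (integrable_signLaw (by fun_prop)), integral_const_mul,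
    h2, integral_signLaw_sq] at h3
  simp at h3
  linarith

/-! ### Random signs conditioned on a small linear functional -/

/-- The sign vectors on which the linear functional `θ` is at most `b`. -/
def slab (θ : Fin d → ℝ) (b : ℝ) : Set (Fin d → ℝ) := {r | |r ⬝ᵥ θ| ≤ b}

theorem measurableSet_slab (θ : Fin d → ℝ) (b : ℝ) : MeasurableSet (slab θ b) :=
  (isClosed_le (continuous_dotProduct_left θ).abs continuous_const).measurableSet

/-- Chebyshev's inequality. The bound is quadratic in the length of θ, which is why conditioning on
the slab is cheap. -/
theorem signLaw_real_slab_compl_le (θ : Fin d → ℝ) {b : ℝ} (hb : 0 < b) :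
    (signLaw d).real (slab θ b)ᶜ ≤ (∑ i, θ i ^ 2) / b ^ 2 := by
  have hc := continuous_dotProduct_left θ
  rw [le_div_iff₀ (by positivity), ← integral_signLaw_sq, mul_comm]
  have h := mul_meas_ge_le_integral_of_nonneg (μ := signLaw d) (f := fun r => (r ⬝ᵥ θ) ^ 2)
    (ae_of_all _ fun r => sq_nonneg _) (integrable_signLaw (by fun_prop)) (b ^ 2)
  refine le_trans (mul_le_mul_of_nonneg_left (measureReal_mono ?_) (sq_nonneg b)) h
  intro r hr
  simp only [slab, Set.mem_compl_iff, Set.mem_ofPred_eq, not_le] at hr ⊢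
  rw [← sq_abs (r ⬝ᵥ θ)]
  exact pow_le_pow_left₀ hb.le hr.le 2

/-- The law of a random sign vector conditioned on the slab of half-width `b`. -/
def slabLaw (θ : Fin d → ℝ) (b : ℝ) : Measure (Fin d → ℝ) := (signLaw d)[|slab θ b]

section SlabLaw

variable {θ : Fin d → ℝ} {b : ℝ}

theorem signLaw_real_slab (θ : Fin d → ℝ) (b : ℝ) :
    (signLaw d).real (slab θ b) = 1 - (signLaw d).real (slab θ b)ᶜ := by
  rw [probReal_compl_eq_one_sub (measurableSet_slab θ b)]; ring

theorem half_le_signLaw_real_slab (hq : (signLaw d).real (slab θ b)ᶜ ≤ 1 / 24) :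
    1 / 2 ≤ (signLaw d).real (slab θ b) := by
  rw [signLaw_real_slab]; linarith

theorem signLaw_slab_ne_zero (hq : (signLaw d).real (slab θ b)ᶜ ≤ 1 / 24) :
    signLaw d (slab θ b) ≠ 0 := by
  intro h
  have := half_le_signLaw_real_slab hq
  rw [measureReal_def, h] at this
  norm_num at this

theorem isProbabilityMeasure_slabLaw (hq : (signLaw d).real (slab θ b)ᶜ ≤ 1 / 24) :
    IsProbabilityMeasure (slabLaw θ b) :=
  cond_isProbabilityMeasure (signLaw_slab_ne_zero hq)

theorem integral_slabLaw (f : (Fin d → ℝ) → ℝ) :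
    ∫ r, f r ∂slabLaw θ b = ((signLaw d).real (slab θ b))⁻¹ * ∫ r in slab θ b, f r ∂signLaw d := by
  rw [slabLaw, ProbabilityTheory.cond, integral_smul_measure, ENNReal.toReal_inv, smul_eq_mul]
  rfl

theorem integrable_slabLaw {f : (Fin d → ℝ) → ℝ} (hf : Continuous f)
    (hq : (signLaw d).real (slab θ b)ᶜ ≤ 1 / 24) : Integrable f (slabLaw θ b) :=
  ((integrable_signLaw hf).restrict).smul_measure
    (ENNReal.inv_ne_top.2 (signLaw_slab_ne_zero hq))

theorem ae_slabLaw_mem : ∀ᵐ r ∂slabLaw θ b, r ∈ slab θ b :=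
  ae_cond_mem (measurableSet_slab θ b)

theorem setIntegral_le_integral_slabLaw {f : (Fin d → ℝ) → ℝ} (h0 : ∀ r, 0 ≤ f r)
    (hq : (signLaw d).real (slab θ b)ᶜ ≤ 1 / 24) :
    ∫ r in slab θ b, f r ∂signLaw d ≤ ∫ r, f r ∂slabLaw θ b := by
  rw [integral_slabLaw]
  refine le_mul_of_one_le_left (integral_nonneg h0) ((one_le_inv₀ ?_).2 measureReal_le_one)
  linarith [half_le_signLaw_real_slab hq]

theorem integral_slabLaw_le {f : (Fin d → ℝ) → ℝ} (hf : Continuous f) (h0 : ∀ r, 0 ≤ f r)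
    (hq : (signLaw d).real (slab θ b)ᶜ ≤ 1 / 24) :
    ∫ r, f r ∂slabLaw θ b ≤ ((signLaw d).real (slab θ b))⁻¹ * ∫ r, f r ∂signLaw d := by
  rw [integral_slabLaw]
  have := half_le_signLaw_real_slab hq
  refine mul_le_mul_of_nonneg_left ?_ (by positivity)
  exact setIntegral_le_integral (integrable_signLaw hf) (ae_of_all _ h0)

theorem inv_signLaw_real_slab_le (hq : (signLaw d).real (slab θ b)ᶜ ≤ 1 / 24) :
    ((signLaw d).real (slab θ b))⁻¹ ≤ 24 / 23 := by
  rw [inv_le_comm₀ (by linarith [half_le_signLaw_real_slab hq]) (by norm_num), signLaw_real_slab]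
  norm_num at hq ⊢
  linarith

theorem integral_slabLaw_sq_le (w : Fin d → ℝ) (hq : (signLaw d).real (slab θ b)ᶜ ≤ 1 / 24) :
    ∫ r, (r ⬝ᵥ w) ^ 2 ∂slabLaw θ b ≤ 2 * ∑ i, w i ^ 2 := by
  have hc := continuous_dotProduct_left w
  refine (integral_slabLaw_le (by fun_prop) (fun r => sq_nonneg _) hq).trans ?_
  rw [integral_signLaw_sq]
  refine mul_le_mul_of_nonneg_right ?_ (Finset.sum_nonneg fun i _ => sq_nonneg _)
  linarith [inv_signLaw_real_slab_le hq]

/-- Here the threshold 1/24 is used in full: y² ≤ 6 + y⁴/24, so the second moment off the slab is at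
most 6/24 + 6/24. -/
theorem half_le_integral_slabLaw_sq {w : Fin d → ℝ} (hw : ∑ i, w i ^ 2 = 1)
    (hq : (signLaw d).real (slab θ b)ᶜ ≤ 1 / 24) :
    1 / 2 ≤ ∫ r, (r ⬝ᵥ w) ^ 2 ∂slabLaw θ b := by
  have hc := continuous_dotProduct_left w
  refine le_trans ?_ (setIntegral_le_integral_slabLaw (fun r => sq_nonneg _) hq)
  have h1 := integral_add_compl (measurableSet_slab θ b)
    (integrable_signLaw (f := fun r => (r ⬝ᵥ w) ^ 2) (by fun_prop))
  rw [integral_signLaw_sq, hw] at h1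
  have h2 : ∫ r in (slab θ b)ᶜ, (r ⬝ᵥ w) ^ 2 ∂signLaw d ≤
      ∫ r in (slab θ b)ᶜ, (6 + 1 / 24 * (r ⬝ᵥ w) ^ 4) ∂signLaw d := by
    refine integral_mono (integrable_signLaw (by fun_prop)).restrict
      (integrable_signLaw (by fun_prop)).restrict fun r => ?_
    dsimp only
    nlinarith [sq_nonneg ((r ⬝ᵥ w) ^ 2 - 12)]
  rw [integral_add (integrable_const _) (integrable_signLaw (by fun_prop)).restrict,
    integral_const_mul] at h2
  have h3 : ∫ r in (slab θ b)ᶜ, (r ⬝ᵥ w) ^ 4 ∂signLaw d ≤ 6 :=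
    (setIntegral_le_integral (integrable_signLaw (by fun_prop))
      (ae_of_all _ fun r => by positivity)).trans (integral_signLaw_pow_four_le hw)
  simp only [integral_const, measureReal_restrict_apply_univ, smul_eq_mul] at h2
  linarith

/-- The slack between √2 and 2 absorbs the normalization: (24/23) · 1.4375 = 3/2. -/
theorem lintegral_slabLaw_exp_sq_le {u : Fin d → ℝ} (hu : ∑ i, u i ^ 2 = 1)
    (hq : (signLaw d).real (slab θ b)ᶜ ≤ 1 / 24) :
    ∫⁻ r, ENNReal.ofReal (Real.exp ((r ⬝ᵥ u) ^ 2 / 2 ^ 2)) ∂slabLaw θ b ≤ 2 := by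
  have hc := continuous_dotProduct_left u
  rw [← ofReal_integral_eq_lintegral_ofReal (integrable_slabLaw (by fun_prop) hq)
      (ae_of_all _ fun g => (Real.exp_pos _).le)]
  refine ENNReal.ofReal_le_of_le_toReal ?_
  refine (integral_slabLaw_le (by fun_prop) (fun r => (Real.exp_pos _).le) hq).trans ?_
  have h1 := integral_signLaw_exp_sq_le hu.le
  have h3 : √2 ≤ 1.4375 := by rw [Real.sqrt_le_left (by norm_num)]; norm_num
  have h4 := inv_signLaw_real_slab_le hq
  norm_num at h1 h3 h4 ⊢
  have h5 : 0 ≤ ((signLaw d).real (slab θ b))⁻¹ := inv_nonneg.2 measureReal_nonneg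
  nlinarith [h1.trans h3]

/-- Compared to a random sign vector, the mean of `|⟨r, θ⟩| - ⟨r, θ⟩ f` over the slab loses at most
a second-order term. -/
theorem sub_le_integral_slabLaw {f : (Fin d → ℝ) → ℝ} (hf : Measurable f) (h1 : ∀ r, |f r| ≤ 1)
    (hb : 0 < b) (hq : (signLaw d).real (slab θ b)ᶜ ≤ 1 / 24) :
    (∫ r, |r ⬝ᵥ θ| ∂signLaw d) - (∫ r, (r ⬝ᵥ θ) * f r ∂signLaw d) - 2 * (∑ i, θ i ^ 2) / b ≤
      ∫ r, (|r ⬝ᵥ θ| - (r ⬝ᵥ θ) * f r) ∂slabLaw θ b := by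
  have hc := continuous_dotProduct_left θ
  have hif : Integrable (fun r => (r ⬝ᵥ θ) * f r) (signLaw d) :=
    (integrable_signLaw hc).mul_bdd (c := 1) hf.aestronglyMeasurable
      (ae_of_all _ fun r => by simpa [Real.norm_eq_abs] using h1 r)
  have hia : Integrable (fun r => |r ⬝ᵥ θ|) (signLaw d) := integrable_signLaw (by fun_prop)
  have hpt : ∀ r, |(r ⬝ᵥ θ) * f r| ≤ |r ⬝ᵥ θ| := fun r => by
    rw [abs_mul]; exact mul_le_of_le_one_right (abs_nonneg _) (h1 r)
  refine le_trans ?_ (setIntegral_le_integral_slabLaw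
    (fun r => by linarith [le_abs_self ((r ⬝ᵥ θ) * f r), hpt r]) hq)
  have h2 := integral_add_compl (measurableSet_slab θ b) (hia.sub hif)
  simp only [Pi.sub_apply] at h2
  rw [integral_sub hia hif] at h2
  -- Off the slab the integrand is at most 2|⟨r, θ⟩|, and there |⟨r, θ⟩| < ⟨r, θ⟩²/b.
  have h3 : ∫ r in (slab θ b)ᶜ, (|r ⬝ᵥ θ| - (r ⬝ᵥ θ) * f r) ∂signLaw d ≤
      ∫ r in (slab θ b)ᶜ, 2 / b * (r ⬝ᵥ θ) ^ 2 ∂signLaw d := by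
    refine setIntegral_mono_on (hia.sub hif).integrableOn
      (integrable_signLaw (by fun_prop)).integrableOn (measurableSet_slab θ b).compl fun r hr => ?_
    simp only [slab, Set.mem_compl_iff, Set.mem_ofPred_eq, not_le] at hr
    have h4 : |r ⬝ᵥ θ| ≤ (r ⬝ᵥ θ) ^ 2 / b := by
      rw [le_div_iff₀ hb, ← sq_abs]
      nlinarith
    have h5 := neg_abs_le ((r ⬝ᵥ θ) * f r)
    rw [show 2 / b * (r ⬝ᵥ θ) ^ 2 = 2 * ((r ⬝ᵥ θ) ^ 2 / b) by ring]
    linarith [hpt r]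
  have h6 : ∫ r in (slab θ b)ᶜ, 2 / b * (r ⬝ᵥ θ) ^ 2 ∂signLaw d ≤ 2 / b * ∑ i, θ i ^ 2 := by
    rw [← integral_signLaw_sq, ← integral_const_mul]
    exact setIntegral_le_integral (integrable_signLaw (by fun_prop))
      (ae_of_all _ fun r => by positivity)
  rw [show 2 * (∑ i, θ i ^ 2) / b = 2 / b * ∑ i, θ i ^ 2 by ring]
  linarith

end SlabLaw

/-! ### Second moments -/

theorem secondMoment_quadratic {Ω : Type*} [MeasurableSpace Ω] {P : Measure Ω}
    {X : Ω → Fin d → ℝ} (hX : ∀ i j, Integrable (fun ω => X ω i * X ω j) P) (w : Fin d → ℝ) :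
    w ⬝ᵥ (secondMoment P X).mulVec w = ∫ ω, (X ω ⬝ᵥ w) ^ 2 ∂P := by
  have h : ∀ ω, (X ω ⬝ᵥ w) ^ 2 = ∑ i, ∑ j, (w i * w j) * (X ω i * X ω j) := fun ω => by
    rw [sq, dotProduct, Finset.sum_mul_sum]
    exact Finset.sum_congr rfl fun i _ => Finset.sum_congr rfl fun j _ => by ring
  simp only [h]
  rw [integral_finsetSum _ fun i _ => integrable_finsetSum _ fun j _ => (hX i j).const_mul _]
  simp only [dotProduct, Matrix.mulVec, Finset.mul_sum]
  refine Finset.sum_congr rfl fun i _ => ?_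
  rw [integral_finsetSum _ fun j _ => (hX i j).const_mul _]
  refine Finset.sum_congr rfl fun j _ => ?_
  rw [integral_const_mul, secondMoment, Matrix.of_apply]
  ring

/-- An eigenvalue is the value of the quadratic form at a normalized eigenvector, so symmetry of S
is not needed. -/
theorem eigenvaluesWithin_of_unit {M : ℝ} {S : Matrix (Fin d) (Fin d) ℝ}
    (h : ∀ w : Fin d → ℝ, ∑ i, w i ^ 2 = 1 → 1 / M < w ⬝ᵥ S.mulVec w ∧ w ⬝ᵥ S.mulVec w < M) :
    EigenvaluesWithin M S := by
  intro l hl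
  obtain ⟨w, hw⟩ := hl.exists_hasEigenvector
  have hS : S.mulVec w = l • w := by simpa using hw.apply_eq_smul
  have hpos : 0 < ∑ i, w i ^ 2 := by
    refine lt_of_le_of_ne (Finset.sum_nonneg fun i _ => sq_nonneg _) fun h0 => hw.2 ?_
    funext i
    have := (Finset.sum_eq_zero_iff_of_nonneg fun i _ => sq_nonneg (w i)).1 h0.symm i
      (Finset.mem_univ i)
    simpa using this
  obtain ⟨ρ, hρ, hρw⟩ : ∃ ρ : ℝ, 0 < ρ ∧ ∑ i, w i ^ 2 = ρ ^ 2 :=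
    ⟨_, Real.sqrt_pos.2 hpos, (Real.sq_sqrt hpos.le).symm⟩
  obtain ⟨v, hv, rfl⟩ := exists_smul_eq hρ hρw
  have hSv : S.mulVec v = l • v := by
    rw [Matrix.mulVec_smul, smul_comm] at hS
    exact smul_right_injective _ hρ.ne' hS
  have hvl : v ⬝ᵥ S.mulVec v = l := by
    rw [hSv, dotProduct_smul, smul_eq_mul]
    have : v ⬝ᵥ v = 1 := by rw [← hv]; simp [dotProduct, sq]
    rw [this, mul_one]
  simpa [hvl] using h v hv

theorem eigenvaluesWithin_slabLaw {θ : Fin d → ℝ} {b M : ℝ} (hM : 4 ≤ M)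
    (hq : (signLaw d).real (slab θ b)ᶜ ≤ 1 / 24) :
    EigenvaluesWithin M (secondMoment (slabLaw θ b) id) := by
  refine eigenvaluesWithin_of_unit fun w hw => ?_
  rw [secondMoment_quadratic fun i j => integrable_slabLaw (by simp only [id]; fun_prop) hq]
  have h1 := half_le_integral_slabLaw_sq hw hq
  have h2 := integral_slabLaw_sq_le w hq
  have h3 : 1 / M ≤ 1 / 4 := one_div_le_one_div_of_le (by norm_num) hM
  simp only [id]
  rw [hw] at h2
  constructor <;> linarith

end

section

/-! ### Sub-Gaussian vectors -/

section SubGaussian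

variable {Ω ι ι' : Type*} [MeasurableSpace Ω] [Fintype ι] [Fintype ι'] {P : Measure Ω}

theorem IsSubGaussian.lintegral_le [IsProbabilityMeasure P] {X : Ω → ι → ℝ} {κ : ℝ}
    (h : IsSubGaussian P X κ) {u : ι → ℝ} (hu : ∑ i, u i ^ 2 ≤ 1) :
    ∫⁻ ω, ENNReal.ofReal (Real.exp ((X ω ⬝ᵥ u) ^ 2 / κ ^ 2)) ∂P ≤ 2 := by
  have h0 : 0 ≤ ∑ i, u i ^ 2 := Finset.sum_nonneg fun i _ => sq_nonneg _
  rcases h0.eq_or_lt with h0 | h0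
  · have : u = 0 := by
      funext i
      simpa using (Finset.sum_eq_zero_iff_of_nonneg fun i _ => sq_nonneg (u i)).1 h0.symm i
        (Finset.mem_univ i)
    simp [this]
  · set ρ := √(∑ i, u i ^ 2) with hρ
    have hρ0 : 0 < ρ := Real.sqrt_pos.2 h0
    have hρ2 : ρ ^ 2 = ∑ i, u i ^ 2 := Real.sq_sqrt h0.le
    refine le_trans (lintegral_mono fun ω => ENNReal.ofReal_le_ofReal (Real.exp_le_exp.2 ?_))
      (h (ρ⁻¹ • u) ?_)
    · rw [dotProduct_smul, smul_eq_mul, mul_pow]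
      refine div_le_div_of_nonneg_right ?_ (sq_nonneg κ)
      refine le_mul_of_one_le_left (sq_nonneg _) ?_
      rw [inv_pow, hρ2]
      exact (one_le_inv₀ h0).2 hu
    · simp only [Pi.smul_apply, smul_eq_mul, mul_pow, ← Finset.mul_sum, ← hρ2]
      field_simp

theorem exp_add_sq_div_le {a b s t κ : ℝ} (hs : 0 < s) (ht : 0 < t) (hκ : s + t ≤ κ) :
    Real.exp ((a + b) ^ 2 / κ ^ 2) ≤ s / (s + t) * Real.exp (a ^ 2 / s ^ 2) +
      t / (s + t) * Real.exp (b ^ 2 / t ^ 2) := by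
  have hst : 0 < s + t := by linarith
  have h1 : (a + b) ^ 2 / κ ^ 2 ≤ s / (s + t) * (a ^ 2 / s ^ 2) + t / (s + t) * (b ^ 2 / t ^ 2) := by
    calc (a + b) ^ 2 / κ ^ 2 ≤ (a + b) ^ 2 / (s + t) ^ 2 :=
          div_le_div_of_nonneg_left (sq_nonneg _) (by positivity) (pow_le_pow_left₀ hst.le hκ 2)
      _ ≤ _ := by
          have : s / (s + t) * (a ^ 2 / s ^ 2) + t / (s + t) * (b ^ 2 / t ^ 2) -
              (a + b) ^ 2 / (s + t) ^ 2 = (a * t - b * s) ^ 2 / ((s + t) ^ 2 * s * t) := by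
            field_simp
            ring
          have h2 : 0 ≤ (a * t - b * s) ^ 2 / ((s + t) ^ 2 * s * t) := by positivity
          linarith
  refine (Real.exp_le_exp.2 h1).trans ?_
  have := convexOn_exp.2 (Set.mem_univ (a ^ 2 / s ^ 2)) (Set.mem_univ (b ^ 2 / t ^ 2))
    (by positivity : 0 ≤ s / (s + t)) (by positivity : 0 ≤ t / (s + t)) (by field_simp)
  simpa [smul_eq_mul] using this

/-- The triangle inequality for the ψ₂-norm: (a + b)/(s + t) is the convex combination of a/s and
b/t with weights s/(s + t) and t/(s + t). No independence of X and Z enters. -/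
theorem IsSubGaussian.sumElim [IsProbabilityMeasure P] {X : Ω → ι → ℝ} {Z : Ω → ι' → ℝ}
    {s t κ : ℝ} (hX : IsSubGaussian P X s) (hZ : IsSubGaussian P Z t) (hXm : Measurable X)
    (hs : 0 < s) (ht : 0 < t) (hκ : s + t ≤ κ) :
    IsSubGaussian P (fun ω => Sum.elim (X ω) (Z ω)) κ := by
  intro u hu
  rw [Fintype.sum_sum_type] at hu
  have hu1 : ∑ i, u (Sum.inl i) ^ 2 ≤ 1 := by
    linarith [Finset.sum_nonneg fun i (_ : i ∈ Finset.univ) => sq_nonneg (u (Sum.inr i))]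
  have hu2 : ∑ i, u (Sum.inr i) ^ 2 ≤ 1 := by
    linarith [Finset.sum_nonneg fun i (_ : i ∈ Finset.univ) => sq_nonneg (u (Sum.inl i))]
  have h1 := hX.lintegral_le hu1
  have h2 := hZ.lintegral_le hu2
  have hst : 0 < s + t := by linarith
  have hpt : ∀ ω, ENNReal.ofReal (Real.exp ((Sum.elim (X ω) (Z ω) ⬝ᵥ u) ^ 2 / κ ^ 2)) ≤
      ENNReal.ofReal (s / (s + t)) *
        ENNReal.ofReal (Real.exp ((X ω ⬝ᵥ fun i => u (Sum.inl i)) ^ 2 / s ^ 2)) +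
      ENNReal.ofReal (t / (s + t)) *
        ENNReal.ofReal (Real.exp ((Z ω ⬝ᵥ fun i => u (Sum.inr i)) ^ 2 / t ^ 2)) := fun ω => by
    rw [← ENNReal.ofReal_mul (by positivity), ← ENNReal.ofReal_mul (by positivity),
      ← ENNReal.ofReal_add (by positivity) (by positivity)]
    refine ENNReal.ofReal_le_ofReal ?_
    have : Sum.elim (X ω) (Z ω) ⬝ᵥ u =
        (X ω ⬝ᵥ fun i => u (Sum.inl i)) + (Z ω ⬝ᵥ fun i => u (Sum.inr i)) := by
      simp [dotProduct, Fintype.sum_sum_type]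
    rw [this]
    exact exp_add_sq_div_le hs ht hκ
  have hm : Measurable fun ω => X ω ⬝ᵥ fun i => u (Sum.inl i) :=
    (Continuous.dotProduct continuous_id continuous_const).measurable.comp hXm
  refine (lintegral_mono hpt).trans ?_
  rw [lintegral_add_left (by fun_prop), lintegral_const_mul' _ _ ENNReal.ofReal_ne_top,
    lintegral_const_mul' _ _ ENNReal.ofReal_ne_top]
  calc _ ≤ ENNReal.ofReal (s / (s + t)) * 2 + ENNReal.ofReal (t / (s + t)) * 2 := by gcongr
    _ = 2 := by
      rw [← add_mul, ← ENNReal.ofReal_add (by positivity) (by positivity), ← add_div,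
        div_self hst.ne']
      simp

theorem isSubGaussian_comp_of_map {Ω' : Type*} [MeasurableSpace Ω'] {P : Measure Ω}
    {f : Ω → Ω'} (hf : Measurable f) {X : Ω' → ι → ℝ} (hX : Measurable X) {κ : ℝ}
    (h : IsSubGaussian (P.map f) X κ) : IsSubGaussian P (fun ω => X (f ω)) κ := by
  intro u hu
  have hm : Measurable fun ω => X ω ⬝ᵥ u :=
    (Continuous.dotProduct continuous_id continuous_const).measurable.comp hX
  have := h u hu
  rwa [lintegral_map (by fun_prop) hf] at this

end SubGaussian

/-! ### The instances -/

variable {K d : ℕ}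
/-- All arms are multiples of one another: the first two are opposite, the others are half the
first one. -/
def armCoeff (k : Fin K) : ℝ := if k.val = 0 then 1 else if k.val = 1 then -1 else 1 / 2

/-- The arms built from a sign vector. -/
def arms (xbar : ℝ) (v : Fin d → ℝ) : Fin K → Fin d → ℝ := fun k j => xbar * armCoeff k * v j

/-- The law of the arms. -/
def armLaw (K d : ℕ) (xbar : ℝ) : Measure (Fin K → Fin d → ℝ) := (signLaw d).map (arms xbar)

/-- The sign attached to a group. -/
def groupSign (g : Fin 2) : ℝ := if g = 0 then 1 else -1

theorem measurable_arms (xbar : ℝ) : Measurable (arms (K := K) (d := d) xbar) := by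
  unfold arms; fun_prop

instance (xbar : ℝ) : IsProbabilityMeasure (armLaw K d xbar) :=
  Measure.isProbabilityMeasure_map (measurable_arms xbar).aemeasurable

theorem abs_armCoeff_le (k : Fin K) : |armCoeff k| ≤ 1 := by
  unfold armCoeff; split_ifs <;> norm_num [abs_le]

theorem quarter_le_armCoeff_sq (k : Fin K) : 1 / 4 ≤ armCoeff k ^ 2 := by
  unfold armCoeff; split_ifs <;> norm_num

theorem groupSign_eq (g : Fin 2) : groupSign g = 1 ∨ groupSign g = -1 := by
  unfold groupSign; split_ifs <;> simp

theorem integrable_armLaw_mul (xbar : ℝ) (k : Fin K) (i j : Fin d) :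
    Integrable (fun x : Fin K → Fin d → ℝ => x k i * x k j) (armLaw K d xbar) := by
  unfold armLaw
  rw [integrable_map_measure (by fun_prop) (measurable_arms xbar).aemeasurable]
  exact integrable_signLaw (by unfold arms; fun_prop)

theorem isSubGaussian_arm {xbar : ℝ} (hx : 0 < xbar) (k : Fin K) :
    IsSubGaussian (armLaw K d xbar) (fun x => x k) (2 * xbar) := by
  intro u hu
  have hm : Measurable fun x : Fin K → Fin d → ℝ => x k ⬝ᵥ u :=
    (continuous_dotProduct_left u).measurable.comp (measurable_pi_apply k)
  unfold armLaw
  rw [lintegral_map (by fun_prop) (measurable_arms xbar)]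
  refine le_trans (lintegral_mono fun v => ENNReal.ofReal_le_ofReal (Real.exp_le_exp.2 ?_))
    ((lintegral_signLaw_exp_sq_le hu.le).trans ?_)
  · have : arms (K := K) xbar v k ⬝ᵥ u = xbar * (armCoeff k * (v ⬝ᵥ u)) := by
      simp only [arms, dotProduct, Finset.mul_sum]
      exact Finset.sum_congr rfl fun i _ => by ring
    rw [this]
    have h2 : (xbar * (armCoeff k * (v ⬝ᵥ u))) ^ 2 / (2 * xbar) ^ 2 =
        armCoeff k ^ 2 * (v ⬝ᵥ u) ^ 2 / 4 := by
      field_simp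
      norm_num
    rw [h2]
    have h3 : armCoeff k ^ 2 ≤ 1 := (sq_le_one_iff_abs_le_one _).2 (abs_armCoeff_le k)
    nlinarith [sq_nonneg (v ⬝ᵥ u)]
  · refine ENNReal.ofReal_le_of_le_toReal ?_
    norm_num

variable [NeZero d]

/-- The instance with opposite rewards `± Lbar` along the first coordinate and arms that are
independent of the customer feature, which has law `ν`. -/
def signInstance (K : ℕ) (xbar Lbar : ℝ) (θ : Fin d → ℝ) (ν : Measure (Fin d → ℝ))
    [IsProbabilityMeasure ν] : Instance K d where
  θ := θ
  β g := Pi.single 0 (groupSign g * Lbar)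
  ctxLaw := (armLaw K d xbar).prod ν
  isProb := inferInstance

variable {xbar Lbar : ℝ} {θ : Fin d → ℝ} {ν : Measure (Fin d → ℝ)} [IsProbabilityMeasure ν]

theorem zLaw_signInstance : (signInstance K xbar Lbar θ ν).zLaw = ν := by
  change ((armLaw K d xbar).prod ν).map Prod.snd = ν
  rw [Measure.map_snd_prod]; simp

theorem map_fst_ctxLaw :
    (signInstance K xbar Lbar θ ν).ctxLaw.map Prod.fst = armLaw K d xbar := by
  change ((armLaw K d xbar).prod ν).map Prod.fst = _
  rw [Measure.map_fst_prod]; simp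

theorem meanReward_signInstance (x : Fin K → Fin d → ℝ) (g : Fin 2) (k : Fin K) :
    (signInstance K xbar Lbar θ ν).meanReward x g k = x k 0 * (groupSign g * Lbar) := by
  simp [Instance.meanReward, signInstance]

theorem isSubGaussian_signInstance {κz κ : ℝ} (hx : 0 < xbar) (hκz : 0 < κz)
    (hκ : 2 * xbar + κz ≤ κ) (hsub : IsSubGaussian ν id κz) (k : Fin K) :
    IsSubGaussian (signInstance K xbar Lbar θ ν).ctxLaw
      (fun c => Sum.elim (c.1 k) c.2) κ := by
  have h1 : IsSubGaussian (signInstance K xbar Lbar θ ν).ctxLaw (fun c : Ctx K d => c.1 k)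
      (2 * xbar) := by
    have := isSubGaussian_arm (K := K) (d := d) hx k
    rw [← map_fst_ctxLaw (Lbar := Lbar) (θ := θ) (ν := ν)] at this
    exact isSubGaussian_comp_of_map (f := Prod.fst) (X := fun x : Fin K → Fin d → ℝ => x k)
      measurable_fst (measurable_pi_apply k) this
  have h2 : IsSubGaussian (signInstance K xbar Lbar θ ν).ctxLaw (fun c : Ctx K d => c.2) κz := by
    rw [← zLaw_signInstance (K := K) (xbar := xbar) (Lbar := Lbar) (θ := θ) (ν := ν)] at hsub
    exact isSubGaussian_comp_of_map (f := Prod.snd) (X := id) measurable_snd measurable_id hsub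
  have hm : Measurable fun c : Ctx K d => c.1 k := (measurable_pi_apply k).comp measurable_fst
  exact h1.sumElim h2 hm (by linarith) hκz hκ

/-- The second moment of arm k is `xbar ^ 2 * armCoeff k ^ 2` times the identity, and the squared
coefficient lies in [1/4, 1]. -/
theorem eigenvaluesWithin_arm {M : ℝ} (hM : 1 < M) (h1 : xbar ^ 2 < M) (h2 : 4 / xbar ^ 2 < M)
    (hx : 0 < xbar) (k : Fin K) :
    EigenvaluesWithin M (secondMoment (signInstance K xbar Lbar θ ν).ctxLaw fun c => c.1 k) := by
  have hmap : ∀ f : (Fin K → Fin d → ℝ) → ℝ, Measurable f →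
      ∫ c, f c.1 ∂(signInstance K xbar Lbar θ ν).ctxLaw = ∫ v, f (arms xbar v) ∂signLaw d := by
    intro f hf
    rw [← integral_map (φ := Prod.fst) measurable_fst.aemeasurable hf.aestronglyMeasurable,
      map_fst_ctxLaw, armLaw, integral_map (measurable_arms xbar).aemeasurable
      hf.aestronglyMeasurable]
  refine eigenvaluesWithin_of_unit fun w hw => ?_
  rw [secondMoment_quadratic]
  · have hm : Measurable fun x : Fin K → Fin d → ℝ => x k ⬝ᵥ w :=
      (continuous_dotProduct_left w).measurable.comp (measurable_pi_apply k)
    rw [hmap (fun x => (x k ⬝ᵥ w) ^ 2) (by fun_prop)]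
    have : ∀ v : Fin d → ℝ, (arms (K := K) xbar v k ⬝ᵥ w) ^ 2 =
        (xbar ^ 2 * armCoeff k ^ 2) * (v ⬝ᵥ w) ^ 2 := fun v => by
      rw [← mul_pow, ← mul_pow]
      congr 1
      simp only [arms, dotProduct, Finset.mul_sum]
      exact Finset.sum_congr rfl fun i _ => by ring
    simp only [this]
    rw [integral_const_mul, integral_signLaw_sq, hw, mul_one]
    have h3 := quarter_le_armCoeff_sq k
    have h4 : armCoeff k ^ 2 ≤ 1 := (sq_le_one_iff_abs_le_one _).2 (abs_armCoeff_le k)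
    have h5 : 0 < xbar ^ 2 := by positivity
    refine ⟨?_, by nlinarith⟩
    rw [div_lt_iff₀ (by positivity)] at h2
    rw [div_lt_iff₀ (by linarith)]
    nlinarith
  · intro i j
    have h := integrable_armLaw_mul xbar k i j
    rw [← map_fst_ctxLaw (Lbar := Lbar) (θ := θ) (ν := ν)] at h
    exact h.comp_measurable measurable_fst

/-! ### Optimal arms and membership in the class. -/

variable [NeZero K]

/-- The sign of the first coordinate of the first arm. -/
def armSign (x : Fin K → Fin d → ℝ) : ℝ := if 0 ≤ x 0 0 then 1 else -1

theorem armCoeff_zero : armCoeff (0 : Fin K) = 1 := by simp [armCoeff]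

theorem armSign_eq (x : Fin K → Fin d → ℝ) : armSign x = 1 ∨ armSign x = -1 := by
  unfold armSign; split_ifs <;> simp

theorem measurable_armSign : Measurable (armSign (K := K) (d := d)) := by
  unfold armSign
  refine Measurable.ite (measurableSet_le measurable_const (by fun_prop)) measurable_const
    measurable_const

theorem le_argmax (v : Fin K → ℝ) (j : Fin K) : v j ≤ v (argmax v) := by
  have := Finset.min'_mem (Finset.univ.filter fun k => ∀ j, v j ≤ v k) (by
    obtain ⟨k, hk⟩ := Finite.exists_max v
    exact ⟨k, by simpa using hk⟩)
  rw [Finset.mem_filter] at this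
  exact this.2 j

/-- Among the two opposite arms, one attains the maximum, and it beats all other arms by half
of its value. -/
theorem argmax_armCoeff (hK : 2 ≤ K) {t s : ℝ} (ht : 0 < t) (hs : s = 1 ∨ s = -1)
    {v : Fin K → ℝ} (hv : ∀ k, v k = t * s * armCoeff k) :
    s * armCoeff (argmax v) = 1 ∧ ∀ k, k ≠ argmax v → s * armCoeff k ≤ 1 / 2 := by
  set a := argmax v with ha
  have hmax : ∀ j, s * armCoeff j ≤ s * armCoeff a := fun j => by
    have := le_argmax v j
    rw [hv, hv, mul_assoc, mul_assoc] at this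
    exact le_of_mul_le_mul_left this ht
  have h0 := hmax ⟨0, by omega⟩
  have h1 := hmax ⟨1, by omega⟩
  rcases hs with rfl | rfl
  · have ha0 : a.val = 0 := by
      by_contra hne
      unfold armCoeff at h0
      rw [if_neg hne] at h0
      split_ifs at h0 <;> norm_num at *
    refine ⟨by simp [armCoeff, ha0], fun k hk => ?_⟩
    have hk0 : k.val ≠ 0 := fun h => hk (Fin.ext (h.trans ha0.symm))
    unfold armCoeff
    rw [if_neg hk0]
    split_ifs <;> norm_num
  · have ha1 : a.val = 1 := by
      by_contra hne
      unfold armCoeff at h1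
      rw [if_neg hne] at h1
      split_ifs at h1 <;> norm_num at *
    refine ⟨by simp [armCoeff, ha1], fun k hk => ?_⟩
    have hk1 : k.val ≠ 1 := fun h => hk (Fin.ext (h.trans ha1.symm))
    unfold armCoeff
    rw [if_neg hk1]
    split_ifs <;> norm_num


theorem ae_armLaw (hx : 0 < xbar) : ∀ᵐ x ∂armLaw K d xbar,
    (∀ k, x k 0 = xbar * armSign x * armCoeff k) ∧ ∀ k j, |x k j| ≤ xbar := by
  unfold armLaw
  rw [ae_map_iff (measurable_arms xbar).aemeasurable]
  · filter_upwards [ae_signLaw] with v hv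
    refine ⟨fun k => ?_, fun k j => ?_⟩
    · have : armSign (arms (K := K) xbar v) = v 0 := by
        unfold armSign arms
        rw [armCoeff_zero]
        rcases hv 0 with h | h <;> rw [h]
        · rw [if_pos (by linarith)]
        · rw [if_neg (by linarith)]
      rw [this, arms]; ring
    · have h1 : |v j| = 1 := by rcases hv j with h | h <;> simp [h]
      rw [arms, abs_mul, abs_mul, h1, abs_of_pos hx, mul_one]
      exact mul_le_of_le_one_right hx.le (abs_armCoeff_le k)
  · have h1 : ∀ k : Fin K, Measurable fun x : Fin K → Fin d → ℝ => xbar * armSign x * armCoeff k :=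
      fun k => (measurable_armSign.const_mul _).mul_const _
    simp only [Set.ofPred_and, Set.ofPred_forall]
    refine (MeasurableSet.iInter fun k => measurableSet_eq_fun (by fun_prop) (h1 k)).inter
      (MeasurableSet.iInter fun k => MeasurableSet.iInter fun j =>
        measurableSet_le (by fun_prop) measurable_const)

theorem ae_meanReward (hx : 0 < xbar) : ∀ᵐ c ∂(signInstance K xbar Lbar θ ν).ctxLaw, ∀ g k,
    (signInstance K xbar Lbar θ ν).meanReward c.1 g k =
      xbar * Lbar * (groupSign g * armSign c.1) * armCoeff k := by
  have h := ae_armLaw (K := K) (d := d) hx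
  rw [← map_fst_ctxLaw (Lbar := Lbar) (θ := θ) (ν := ν)] at h
  filter_upwards [ae_of_ae_map measurable_fst.aemeasurable h] with c hc g k
  rw [meanReward_signInstance, hc.1 k]; ring

theorem groupSign_mul_armSign (g : Fin 2) (x : Fin K → Fin d → ℝ) :
    groupSign g * armSign x = 1 ∨ groupSign g * armSign x = -1 := by
  rcases groupSign_eq g with h | h <;> rcases armSign_eq x with h' | h' <;> simp [h, h']

/-- The instances belong to the class. -/
theorem inClass_signInstance {s : ℕ} {ξ M κz κ C hbar : ℝ} (hK : 2 ≤ K) (hs : 1 ≤ s)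
    (hx : 0 < xbar) (hL : 0 < Lbar) (hM : 1 < M) (hM1 : xbar ^ 2 < M) (hM2 : 4 / xbar ^ 2 < M)
    (hκz : 0 < κz) (hκ : 2 * xbar + κz ≤ κ) (hC : 0 < C) (hh : hbar ≤ xbar * Lbar / 4)
    (hθ : IsSparse s θ) (hnd : NondegenerateGroups ξ θ ν) (hsub : IsSubGaussian ν id κz)
    (heig : EigenvaluesWithin M (secondMoment ν id)) :
    InClass s xbar Lbar ξ M κ C hbar (signInstance K xbar Lbar θ ν) where
  sparse_theta := hθ
  sparse_beta g := by
    refine le_trans (Finset.card_le_card (t := {0}) fun j hj => ?_) (by simpa using hs)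
    rw [Finset.mem_filter] at hj
    rw [Finset.mem_singleton]
    by_contra hne
    exact hj.2 (by simp [signInstance, hne])
  beta_ne h := by
    have := congrFun h 0
    simp [signInstance, groupSign] at this
    linarith
  nondegenerate := by rw [zLaw_signInstance]; exact hnd
  subGaussian k := isSubGaussian_signInstance hx hκz hκ hsub k
  eigenvalues_x k := eigenvaluesWithin_arm hM hM1 hM2 hx k
  eigenvalues_z := by rw [zLaw_signInstance]; exact heig
  bounded_x := by
    have h := ae_armLaw (K := K) (d := d) hx
    rw [← map_fst_ctxLaw (Lbar := Lbar) (θ := θ) (ν := ν)] at h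
    filter_upwards [ae_of_ae_map measurable_fst.aemeasurable h] with c hc using hc.2
  bounded_beta g := by
    have : ∀ j, |(signInstance K xbar Lbar θ ν).β g j| = (Pi.single 0 Lbar : Fin d → ℝ) j := by
      intro j
      by_cases hj : j = 0
      · subst hj
        rcases groupSign_eq g with h | h <;> simp [signInstance, h, abs_of_pos hL]
      · simp [signInstance, hj]
    simp [this]
  -- The best arm leads by at least `xbar * Lbar / 2`, twice the largest admissible `hbar`, so the
  -- event is null and any C > 0 will do.
  margin g h hh' := by
    refine le_trans (le_of_eq ?_) (mul_nonneg hC.le hh'.1)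
    rw [measureReal_def, measure_eq_zero_iff_ae_notMem.2, ENNReal.toReal_zero]
    filter_upwards [ae_meanReward (K := K) (Lbar := Lbar) (θ := θ) (ν := ν) hx] with c hc
    rintro ⟨k, hk, hle⟩
    have ht : 0 < xbar * Lbar := mul_pos hx hL
    obtain ⟨h1, h2⟩ := argmax_armCoeff hK ht (groupSign_mul_armSign g c.1) (hc g)
    have h3 := h2 k hk
    rw [hc g, hc g, mul_assoc, mul_assoc (xbar * Lbar), h1] at hle
    have := hh'.2
    nlinarith

end

section

/-! ### One round of the interaction -/

section Round

variable {K d : ℕ} (μ : Instance K d) (σ : ℝ≥0) (π : Policy K d)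

theorem fst_latentLaw : (μ.latentLaw σ).fst = μ.ctxLaw := Measure.fst_compProd _ _

/-- A new customer is independent of the history, so the marginal law does not depend on n or on the
policy. -/
theorem fst_roundLaw (n : ℕ) : (roundLaw μ σ π n).fst = μ.latentLaw σ := by
  have h : roundLaw μ σ π n = (roundKernel μ σ π n) ∘ₘ (histLaw μ σ π n) :=
    Measure.snd_compProd _ _
  have h2 : (roundKernel μ σ π n).map Prod.fst = Kernel.const _ (μ.latentLaw σ) := by
    rw [← Kernel.fst_eq, roundKernel, Kernel.fst_compProd]
  rw [h, Measure.fst, Measure.map_comp _ _ measurable_fst, h2, Measure.const_comp]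
  simp

instance (n : ℕ) : IsProbabilityMeasure (roundLaw μ σ π n) :=
  Measure.isProbabilityMeasure_map measurable_snd.aemeasurable

theorem ae_roundLaw (n : ℕ) {p : Ctx K d → Prop} (hp : ∀ᵐ c ∂μ.ctxLaw, p c) :
    ∀ᵐ w ∂roundLaw μ σ π n, p w.1.1 := by
  rw [← fst_latentLaw μ σ] at hp
  have h := ae_of_ae_map measurable_fst.aemeasurable hp
  rw [← fst_roundLaw μ σ π n] at h
  exact ae_of_ae_map measurable_fst.aemeasurable h

/-- Integration of a function of the features, the group and the arm. -/
theorem integral_roundLaw (n : ℕ) {f : Ctx K d → Fin 2 → Fin K → ℝ}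
    (hf : Measurable fun q : Ctx K d × Fin 2 × Fin K => f q.1 q.2.1 q.2.2) {C : ℝ}
    (hC : ∀ c g a, |f c g a| ≤ C) :
    ∫ w, f w.1.1 w.1.2.1 w.2 ∂roundLaw μ σ π n =
      ∫ h, ∫ c, ∫ g, ∫ a, f c g a ∂π.act n (h, c) ∂groupKernel μ.θ c.2 ∂μ.ctxLaw
        ∂histLaw μ σ π n := by
  have hm : Measurable fun w : (Ctx K d × Fin 2 × ℝ) × Fin K => f w.1.1 w.1.2.1 w.2 :=
    hf.comp (by fun_prop : Measurable fun w : (Ctx K d × Fin 2 × ℝ) × Fin K =>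
      (w.1.1, w.1.2.1, w.2))
  have hi : Integrable (fun q : Hist K d n × (Ctx K d × Fin 2 × ℝ) × Fin K =>
      f q.2.1.1 q.2.1.2.1 q.2.2) (histLaw μ σ π n ⊗ₘ roundKernel μ σ π n) :=
    integrable_of_abs_le (hm.comp measurable_snd) fun q => hC _ _ _
  rw [roundLaw, integral_map measurable_snd.aemeasurable hm.aestronglyMeasurable,
    Measure.integral_compProd hi]
  refine integral_congr_ae (ae_of_all _ fun h => ?_)
  simp only
  rw [roundKernel, integral_compProd (integrable_of_abs_le hm fun q => hC _ _ _)]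
  simp only [Kernel.const_apply, Kernel.comap_apply]
  have hm1 : Measurable fun w : Ctx K d × Fin 2 × ℝ => ∫ a, f w.1 w.2.1 a ∂π.act n (h, w.1) := by
    have := (hm.stronglyMeasurable).integral_kernel_prod_right'
      (κ := (π.act n).comap (fun w : Ctx K d × Fin 2 × ℝ => (h, w.1)) (by fun_prop))
    exact this.measurable
  have hb1 : ∀ w : Ctx K d × Fin 2 × ℝ, |∫ a, f w.1 w.2.1 a ∂π.act n (h, w.1)| ≤ C := fun w =>
    abs_integral_le_of_abs_le fun a => hC _ _ _
  rw [Instance.latentLaw, Measure.integral_compProd (integrable_of_abs_le hm1 hb1)]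
  refine integral_congr_ae (ae_of_all _ fun c => ?_)
  simp only [Kernel.prod_apply, Kernel.comap_apply, Kernel.const_apply]
  rw [integral_fun_fst (f := fun g => ∫ a, f c g a ∂π.act n (h, c))]
  simp

end Round

/-! ### The mean response of a policy -/

section Response

variable {K d : ℕ}

theorem integral_groupSign (θ z : Fin d → ℝ) :
    ∫ g, groupSign g ∂groupKernel θ z = groupBias (z ⬝ᵥ θ) := by
  rw [integral_groupKernel, groupBias]
  simp [groupSign]
  ring

theorem groupSign_classify_mul (θ z : Fin d → ℝ) :
    groupSign (classify θ z) * groupBias (z ⬝ᵥ θ) = |groupBias (z ⬝ᵥ θ)| := by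
  unfold groupSign classify groupBias
  split_ifs with h h' h'
  · rw [abs_of_nonneg (by linarith)]; ring
  · exact absurd rfl h'
  · simp at h'
  · rw [abs_of_neg (by linarith)]; ring

theorem measurable_groupSign_classify (θ : Fin d → ℝ) :
    Measurable fun z => groupSign (classify θ z) := by
  have : Measurable (classify θ) := Measurable.ite (measurableSet_le measurable_const
    (continuous_sigmoid.comp (continuous_dotProduct_left θ)).measurable) measurable_const
    measurable_const
  exact (measurable_of_finite groupSign).comp this

theorem abs_groupSign (g : Fin 2) : |groupSign g| = 1 := by
  rcases groupSign_eq g with h | h <;> simp [h]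

theorem measurable_groupBias_dotProduct (θ : Fin d → ℝ) :
    Measurable fun z : Fin d → ℝ => groupBias (z ⬝ᵥ θ) :=
  (continuous_groupBias.comp (continuous_dotProduct_left θ)).measurable

/-- Given z, the Bayes classifier errs with the smaller of the two group probabilities, which is (1
- |bias|)/2. -/
theorem misclassError_eq (θ : Fin d → ℝ) (ν : Measure (Fin d → ℝ)) [IsProbabilityMeasure ν] :
    misclassError θ ν = ∫ z, (1 - |groupBias (z ⬝ᵥ θ)|) / 2 ∂ν := by
  have hm : Measurable fun q : (Fin d → ℝ) × Fin 2 =>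
      (1 - groupSign (classify θ q.1) * groupSign q.2) / 2 := by
    have h1 := (measurable_groupSign_classify θ).comp
      (measurable_fst : Measurable (Prod.fst : (Fin d → ℝ) × Fin 2 → _))
    have h2 := (measurable_of_finite groupSign).comp
      (measurable_snd : Measurable (Prod.snd : (Fin d → ℝ) × Fin 2 → _))
    exact ((h1.mul h2).const_sub 1).div_const 2
  have hind : ∀ q : (Fin d → ℝ) × Fin 2, (1 - groupSign (classify θ q.1) * groupSign q.2) / 2 =
      {q : (Fin d → ℝ) × Fin 2 | classify θ q.1 ≠ q.2}.indicator (fun _ => (1 : ℝ)) q := by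
    intro q
    have h : ∀ a b : Fin 2, (1 - groupSign a * groupSign b) / 2 = if a ≠ b then 1 else 0 := by
      intro a b
      fin_cases a <;> fin_cases b <;> norm_num [groupSign]
    simp [h, Set.indicator_apply]
  have hS : MeasurableSet {q : (Fin d → ℝ) × Fin 2 | classify θ q.1 ≠ q.2} := by
    have : {q : (Fin d → ℝ) × Fin 2 | classify θ q.1 ≠ q.2} =
        (fun q => (1 - groupSign (classify θ q.1) * groupSign q.2) / 2) ⁻¹' {1} := by
      ext q
      rw [Set.mem_preimage, hind]
      simp [Set.indicator_apply]
    rw [this]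
    exact hm (measurableSet_singleton 1)
  rw [misclassError, ← integral_indicator_one hS, Measure.integral_compProd]
  · refine integral_congr_ae (ae_of_all _ fun z => ?_)
    have : ∀ g, {q : (Fin d → ℝ) × Fin 2 | classify θ q.1 ≠ q.2}.indicator
        (1 : (Fin d → ℝ) × Fin 2 → ℝ) (z, g) =
        (1 - groupSign (classify θ z) * groupSign g) / 2 := fun g => (hind (z, g)).symm
    simp only [this]
    rw [integral_div, integral_sub (integrable_const _) (Integrable.of_finite),
      integral_const_mul, integral_groupSign, groupSign_classify_mul]
    simp
  · exact (integrable_const (1 : ℝ)).indicator hS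

variable [NeZero K] [NeZero d]

/-- The mean of the signed coefficient of the arm chosen by a policy, given the history and the
customer feature. -/
def response (π : Policy K d) (xbar : ℝ) (n : ℕ) (h : Hist K d n) (z : Fin d → ℝ) : ℝ :=
  ∫ x, ∫ a, armSign x * armCoeff a ∂π.act n (h, (x, z)) ∂armLaw K d xbar

theorem abs_armSign_mul_le (x : Fin K → Fin d → ℝ) (a : Fin K) :
    |armSign x * armCoeff a| ≤ 1 := by
  rw [abs_mul]
  have : |armSign x| = 1 := by rcases armSign_eq x with h | h <;> simp [h]
  rw [this, one_mul]
  exact abs_armCoeff_le a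

theorem measurable_armSign_mul : Measurable fun q : Ctx K d × Fin K =>
    armSign q.1.1 * armCoeff q.2 := by
  have h1 := (measurable_armSign (K := K) (d := d)).comp
    ((measurable_fst.comp measurable_fst : Measurable fun q : Ctx K d × Fin K => q.1.1))
  have h2 := (measurable_of_finite (armCoeff (K := K))).comp
    (measurable_snd : Measurable (Prod.snd : Ctx K d × Fin K → _))
  exact h1.mul h2

theorem abs_response_le (π : Policy K d) (xbar : ℝ) (n : ℕ) (h : Hist K d n) (z : Fin d → ℝ) :
    |response π xbar n h z| ≤ 1 :=
  abs_integral_le_of_abs_le fun x => abs_integral_le_of_abs_le fun a => abs_armSign_mul_le x a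

theorem measurable_integral_act (π : Policy K d) (n : ℕ) :
    Measurable fun q : Hist K d n × Ctx K d =>
      ∫ a, armSign q.2.1 * armCoeff a ∂π.act n q := by
  have := (measurable_armSign_mul.comp (by fun_prop : Measurable
    fun q : (Hist K d n × Ctx K d) × Fin K => (q.1.2, q.2))).stronglyMeasurable
  exact (this.integral_kernel_prod_right' (κ := π.act n)).measurable

theorem measurable_response (π : Policy K d) (xbar : ℝ) (n : ℕ) :
    Measurable fun q : Hist K d n × (Fin d → ℝ) => response π xbar n q.1 q.2 := by
  have := ((measurable_integral_act π n).comp (by fun_prop : Measurable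
    fun q : (Hist K d n × (Fin d → ℝ)) × (Fin K → Fin d → ℝ) =>
      (q.1.1, (q.2, q.1.2)))).stronglyMeasurable
  exact (this.integral_prod_right' (ν := armLaw K d xbar)).measurable

variable {xbar Lbar : ℝ} {θ : Fin d → ℝ} {ν : Measure (Fin d → ℝ)} [IsProbabilityMeasure ν]
  (σ : ℝ≥0) (π : Policy K d) (n : ℕ)

/-- The policy does not see the group, so given history and features the group sign and the arm are
independent. Since the arm vectors are independent of z, they can be averaged out into `response`.
-/
theorem integral_roundLaw_response :
    ∫ w, groupSign w.1.2.1 * (armSign w.1.1.1 * armCoeff w.2)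
        ∂roundLaw (signInstance K xbar Lbar θ ν) σ π n =
      ∫ h, ∫ z, groupBias (z ⬝ᵥ θ) * response π xbar n h z ∂ν
        ∂histLaw (signInstance K xbar Lbar θ ν) σ π n := by
  rw [integral_roundLaw _ σ π n (f := fun c g a => groupSign g * (armSign c.1 * armCoeff a))
    (C := 1)]
  · refine integral_congr_ae (ae_of_all _ fun h => ?_)
    have h1 : ∀ c : Ctx K d, ∫ g, ∫ a, groupSign g * (armSign c.1 * armCoeff a) ∂π.act n (h, c)
        ∂groupKernel θ c.2 =
        groupBias (c.2 ⬝ᵥ θ) * ∫ a, armSign c.1 * armCoeff a ∂π.act n (h, c) := fun c => by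
      simp only [integral_const_mul]
      rw [integral_mul_const, integral_groupSign]
    change ∫ c, ∫ g, ∫ a, groupSign g * (armSign c.1 * armCoeff a) ∂π.act n (h, c)
        ∂groupKernel θ c.2 ∂((armLaw K d xbar).prod ν) = _
    simp only [h1]
    rw [integral_prod_symm]
    · refine integral_congr_ae (ae_of_all _ fun z => ?_)
      simp only
      rw [integral_const_mul, response]
    · refine integrable_of_abs_le (C := 1) ?_ fun c => ?_
      · exact ((measurable_groupBias_dotProduct θ).comp measurable_snd).mul
          ((measurable_integral_act π n).comp measurable_prodMk_left)
      · rw [abs_mul]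
        exact mul_le_one₀ (abs_groupBias_le_one _) (abs_nonneg _)
          (abs_integral_le_of_abs_le fun a => abs_armSign_mul_le c.1 a)
  · exact ((measurable_of_finite groupSign).comp (by fun_prop : Measurable
      fun q : Ctx K d × Fin 2 × Fin K => q.2.1)).mul
      (measurable_armSign_mul.comp (by fun_prop : Measurable
        fun q : Ctx K d × Fin 2 × Fin K => (q.1, q.2.2)))
  · intro c g a
    rw [abs_mul, abs_groupSign, one_mul]
    exact abs_armSign_mul_le _ _

omit [NeZero K] in
theorem integral_roundLaw_classify :
    ∫ w, groupSign (classify θ w.1.1.2) * groupSign w.1.2.1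
        ∂roundLaw (signInstance K xbar Lbar θ ν) σ π n =
      ∫ z, |groupBias (z ⬝ᵥ θ)| ∂ν := by
  rw [integral_roundLaw _ σ π n (f := fun c g a => groupSign (classify θ c.2) * groupSign g)
    (C := 1)]
  · have h1 : ∀ (h : Hist K d n) (c : Ctx K d),
        ∫ g, ∫ a, groupSign (classify θ c.2) * groupSign g ∂π.act n (h, c)
        ∂groupKernel θ c.2 = |groupBias (c.2 ⬝ᵥ θ)| := fun h c => by
      simp only [integral_const, probReal_univ, one_smul]
      rw [integral_const_mul, integral_groupSign, groupSign_classify_mul]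
    have h2 : ∀ h : Hist K d n, ∫ c, ∫ g, ∫ a, groupSign (classify θ c.2) * groupSign g
        ∂π.act n (h, c) ∂groupKernel (signInstance K xbar Lbar θ ν).θ c.2
        ∂(signInstance K xbar Lbar θ ν).ctxLaw = ∫ z, |groupBias (z ⬝ᵥ θ)| ∂ν := fun h => by
      change ∫ c, ∫ g, ∫ a, groupSign (classify θ c.2) * groupSign g
        ∂π.act n (h, c) ∂groupKernel θ c.2 ∂((armLaw K d xbar).prod ν) = _
      simp only [h1]
      rw [integral_fun_snd (f := fun z => |groupBias (z ⬝ᵥ θ)|)]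
      simp
    simp only [h2]
    simp
  · exact ((measurable_groupSign_classify θ).comp (by fun_prop : Measurable
      fun q : Ctx K d × Fin 2 × Fin K => q.1.2)).mul ((measurable_of_finite groupSign).comp
        (by fun_prop : Measurable fun q : Ctx K d × Fin 2 × Fin K => q.2.1))
  · intro c g a
    rw [abs_mul, abs_groupSign, abs_groupSign, one_mul]

theorem integrable_roundLaw_response :
    Integrable (fun w => groupSign w.1.2.1 * (armSign w.1.1.1 * armCoeff w.2))
      (roundLaw (signInstance K xbar Lbar θ ν) σ π n) :=
  integrable_of_abs_le (C := 1)
    (((measurable_of_finite groupSign).comp (by fun_prop : Measurable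
      fun q : (Ctx K d × Fin 2 × ℝ) × Fin K => q.1.2.1)).mul
      (measurable_armSign_mul.comp (by fun_prop : Measurable
        fun q : (Ctx K d × Fin 2 × ℝ) × Fin K => (q.1.1, q.2))))
    fun w => by rw [abs_mul, abs_groupSign, one_mul]; exact abs_armSign_mul_le _ _

omit [NeZero K] in
theorem integrable_roundLaw_classify :
    Integrable (fun w => groupSign (classify θ w.1.1.2) * groupSign w.1.2.1)
      (roundLaw (signInstance K xbar Lbar θ ν) σ π n) :=
  integrable_of_abs_le (C := 1)
    (((measurable_groupSign_classify θ).comp (by fun_prop : Measurable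
      fun q : (Ctx K d × Fin 2 × ℝ) × Fin K => q.1.1.2)).mul ((measurable_of_finite groupSign).comp
        (by fun_prop : Measurable fun q : (Ctx K d × Fin 2 × ℝ) × Fin K => q.1.2.1)))
    fun w => by rw [abs_mul, abs_groupSign, abs_groupSign, one_mul]

theorem integrable_groupBias_mul_response (h : Hist K d n) :
    Integrable (fun z => groupBias (z ⬝ᵥ θ) * response π xbar n h z) ν :=
  integrable_of_abs_le (C := 1) ((measurable_groupBias_dotProduct θ).mul
    ((measurable_response π xbar n).comp measurable_prodMk_left)) fun z => by
      rw [abs_mul]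
      exact mul_le_one₀ (abs_groupBias_le_one _) (abs_nonneg _) (abs_response_le _ _ _ _ _)

omit [NeZero d] in
theorem integrable_abs_groupBias : Integrable (fun z : Fin d → ℝ => |groupBias (z ⬝ᵥ θ)|) ν :=
  integrable_of_abs_le (C := 1) (measurable_groupBias_dotProduct θ).abs fun z => by
    rw [abs_abs]; exact abs_groupBias_le_one _

theorem integrable_integral_groupBias_mul_response (P : Measure (Hist K d n))
    [IsProbabilityMeasure P] :
    Integrable (fun h => ∫ z, groupBias (z ⬝ᵥ θ) * response π xbar n h z ∂ν) P := by
  have hm : Measurable fun q : Hist K d n × (Fin d → ℝ) =>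
      groupBias (q.2 ⬝ᵥ θ) * response π xbar n q.1 q.2 :=
    ((measurable_groupBias_dotProduct θ).comp measurable_snd).mul (measurable_response π xbar n)
  refine integrable_of_abs_le (C := 1)
    (hm.stronglyMeasurable.integral_prod_right' (ν := ν)).measurable fun h => ?_
  refine abs_integral_le_of_abs_le fun z => ?_
  rw [abs_mul]
  exact mul_le_one₀ (abs_groupBias_le_one _) (abs_nonneg _) (abs_response_le _ _ _ _ _)

/-- The mean instant regular regret. -/
theorem integral_instantRegular (hK : 2 ≤ K) (hx : 0 < xbar) (hL : 0 < Lbar) :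
    ∫ w, instantRegular (signInstance K xbar Lbar θ ν) w
        ∂roundLaw (signInstance K xbar Lbar θ ν) σ π n =
      xbar * Lbar * ∫ h, ∫ z, (|groupBias (z ⬝ᵥ θ)| - groupBias (z ⬝ᵥ θ) * response π xbar n h z) ∂ν
        ∂histLaw (signInstance K xbar Lbar θ ν) σ π n := by
  have ht : 0 < xbar * Lbar := mul_pos hx hL
  have h1 : ∫ w, instantRegular (signInstance K xbar Lbar θ ν) w
        ∂roundLaw (signInstance K xbar Lbar θ ν) σ π n =
      ∫ w, xbar * Lbar * (groupSign (classify θ w.1.1.2) * groupSign w.1.2.1 -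
          groupSign w.1.2.1 * (armSign w.1.1.1 * armCoeff w.2))
        ∂roundLaw (signInstance K xbar Lbar θ ν) σ π n := by
    refine integral_congr_ae ?_
    filter_upwards [ae_roundLaw _ σ π n (ae_meanReward (K := K) (Lbar := Lbar) (θ := θ) (ν := ν) hx)]
      with w hw
    rw [instantRegular, hw, hw]
    have h2 := (argmax_armCoeff hK ht (groupSign_mul_armSign (classify θ w.1.1.2) w.1.1.1)
      (hw (classify θ w.1.1.2))).1
    -- The regular oracle predicts exactly the sign of the classified group.
    have h3 : armSign w.1.1.1 * armCoeff (regularArm (signInstance K xbar Lbar θ ν) w.1.1) =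
        groupSign (classify θ w.1.1.2) := by
      change groupSign (classify θ w.1.1.2) * armSign w.1.1.1 *
        armCoeff (regularArm (signInstance K xbar Lbar θ ν) w.1.1) = 1 at h2
      rcases groupSign_eq (classify θ w.1.1.2) with h | h <;> rw [h] at h2 ⊢ <;> linarith
    rw [← h3]
    ring
  rw [h1, integral_const_mul, integral_sub (integrable_roundLaw_classify σ π n)
    (integrable_roundLaw_response σ π n), integral_roundLaw_classify, integral_roundLaw_response]
  congr 1
  have h4 : ∀ h : Hist K d n,
      ∫ z, (|groupBias (z ⬝ᵥ θ)| - groupBias (z ⬝ᵥ θ) * response π xbar n h z) ∂ν =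
      (∫ z, |groupBias (z ⬝ᵥ θ)| ∂ν) - ∫ z, groupBias (z ⬝ᵥ θ) * response π xbar n h z ∂ν :=
    fun h => integral_sub integrable_abs_groupBias (integrable_groupBias_mul_response π n h)
  simp only [h4]
  rw [integral_sub (integrable_const _)]
  · simp
  · exact integrable_integral_groupBias_mul_response π n _

/-- The mean instant strong regret is at least twice the misclassification error. -/
theorem le_integral_instantStrong (hK : 2 ≤ K) (hx : 0 < xbar) (hL : 0 < Lbar) :
    2 * (xbar * Lbar * misclassError θ ν) ≤ ∫ w, instantStrong (signInstance K xbar Lbar θ ν) w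
        ∂roundLaw (signInstance K xbar Lbar θ ν) σ π n := by
  have ht : 0 < xbar * Lbar := mul_pos hx hL
  have h1 : ∫ w, instantStrong (signInstance K xbar Lbar θ ν) w
        ∂roundLaw (signInstance K xbar Lbar θ ν) σ π n =
      ∫ w, xbar * Lbar * (1 - groupSign w.1.2.1 * (armSign w.1.1.1 * armCoeff w.2))
        ∂roundLaw (signInstance K xbar Lbar θ ν) σ π n := by
    refine integral_congr_ae ?_
    filter_upwards [ae_roundLaw _ σ π n (ae_meanReward (K := K) (Lbar := Lbar) (θ := θ) (ν := ν) hx)]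
      with w hw
    have h2 := (argmax_armCoeff hK ht (groupSign_mul_armSign w.1.2.1 w.1.1.1) (hw w.1.2.1)).1
    have h3 : ⨆ k, (signInstance K xbar Lbar θ ν).meanReward w.1.1.1 w.1.2.1 k = xbar * Lbar := by
      refine le_antisymm (ciSup_le fun k => ?_) ?_
      · refine (le_argmax _ k).trans ?_
        rw [hw, mul_assoc, h2, mul_one]
      · refine le_trans ?_ (le_ciSup (Set.finite_range _).bddAbove
          (argmax ((signInstance K xbar Lbar θ ν).meanReward w.1.1.1 w.1.2.1)))
        rw [hw, mul_assoc, h2, mul_one]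
    rw [instantStrong, h3, hw]
    ring
  rw [h1, integral_const_mul, integral_sub (integrable_const _)
    (integrable_roundLaw_response σ π n), integral_roundLaw_response, misclassError_eq,
    integral_div, integral_sub (integrable_const _) integrable_abs_groupBias]
  simp only [integral_const, probReal_univ, one_smul]
  -- Whatever the history, no prediction in [-1, 1] beats the sign of the bias.
  have h4 : ∀ h : Hist K d n, ∫ z, groupBias (z ⬝ᵥ θ) * response π xbar n h z ∂ν ≤
      ∫ z, |groupBias (z ⬝ᵥ θ)| ∂ν := fun h => by
    refine integral_mono (integrable_groupBias_mul_response π n h) integrable_abs_groupBias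
      fun z => (le_abs_self _).trans ?_
    rw [abs_mul]
    exact mul_le_of_le_one_right (abs_nonneg _) (abs_response_le _ _ _ _ _)
  have h5 : ∫ h, ∫ z, groupBias (z ⬝ᵥ θ) * response π xbar n h z ∂ν
        ∂histLaw (signInstance K xbar Lbar θ ν) σ π n ≤ ∫ z, |groupBias (z ⬝ᵥ θ)| ∂ν := by
    have := integral_mono (integrable_integral_groupBias_mul_response π n
      (histLaw (signInstance K xbar Lbar θ ν) σ π n)) (integrable_const _) h4
    simpa using this
  nlinarith

end Response

end

section

/-! ### Comparison of the laws of the histories -/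

section HistoryEntropy

variable {K d : ℕ} [NeZero d] {xbar Lbar : ℝ} {θ : Fin d → ℝ}
  {ν ν₀ : Measure (Fin d → ℝ)} [IsProbabilityMeasure ν] [IsProbabilityMeasure ν₀] {k : ℝ}

/-- Arms and noise have the same law in both instances; only the law of z (cost k) and the group
given z (cost ⟨z, θ⟩²) contribute. -/
theorem entropyBound_latentLaw (σ : ℝ≥0) (h : EntropyBound ν ν₀ k)
    (hi : Integrable (fun z => (z ⬝ᵥ θ) ^ 2) ν) :
    EntropyBound ((signInstance K xbar Lbar θ ν).latentLaw σ)
      ((signInstance K xbar Lbar 0 ν₀).latentLaw σ) (k + ∫ z, (z ⬝ᵥ θ) ^ 2 ∂ν) := by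
  have h1 := ((EntropyBound.refl (armLaw K d xbar)).prod h).compProd
    (κ := ((groupKernel θ).comap Prod.snd measurable_snd) ×ₖ
      Kernel.const (Ctx K d) (gaussianReal 0 (σ ^ 2)))
    (η := ((groupKernel 0).comap Prod.snd measurable_snd) ×ₖ
      Kernel.const (Ctx K d) (gaussianReal 0 (σ ^ 2)))
    (l := fun c => (c.2 ⬝ᵥ θ) ^ 2) (fun c => by
      simp only [Kernel.prod_apply, Kernel.comap_apply, Kernel.const_apply]
      simpa using (entropyBound_groupKernel θ c.2).prod (EntropyBound.refl _)) (hi.comp_snd _)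
  rw [integral_fun_snd (f := fun z => (z ⬝ᵥ θ) ^ 2), probReal_univ, one_smul, zero_add] at h1
  exact h1

/-- The chain rule over rounds. Both interactions use the same policy, so its random choices are
free, and every round costs the same amount. -/
theorem entropyBound_histLaw (σ : ℝ≥0) (π : Policy K d) (h : EntropyBound ν ν₀ k)
    (hi : Integrable (fun z => (z ⬝ᵥ θ) ^ 2) ν) (n : ℕ) :
    EntropyBound (histLaw (signInstance K xbar Lbar θ ν) σ π n)
      (histLaw (signInstance K xbar Lbar 0 ν₀) σ π n) (n * (k + ∫ z, (z ⬝ᵥ θ) ^ 2 ∂ν)) := by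
  induction n with
  | zero =>
    simp only [histLaw, Nat.cast_zero, zero_mul]
    exact EntropyBound.refl _
  | succ n ih =>
    have hr : ∀ g : Hist K d n, EntropyBound (roundKernel (signInstance K xbar Lbar θ ν) σ π n g)
        (roundKernel (signInstance K xbar Lbar 0 ν₀) σ π n g) (k + ∫ z, (z ⬝ᵥ θ) ^ 2 ∂ν) := by
      intro g
      have h1 := (entropyBound_latentLaw (K := K) (xbar := xbar) (Lbar := Lbar) σ h hi).compProd
        (κ := (π.act n).comap (fun q : Ctx K d × Fin 2 × ℝ => (g, q.1)) (by fun_prop))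
        (η := (π.act n).comap (fun q : Ctx K d × Fin 2 × ℝ => (g, q.1)) (by fun_prop))
        (l := fun _ => 0) (fun a => EntropyBound.refl _) (integrable_const _)
      simp only [integral_zero, add_zero] at h1
      have h2 : ∀ (μ : Instance K d), roundKernel μ σ π n g = μ.latentLaw σ ⊗ₘ
          (π.act n).comap (fun q : Ctx K d × Fin 2 × ℝ => (g, q.1)) (by fun_prop) := by
        intro μ
        rw [roundKernel, Kernel.compProd_apply_eq_compProd_sectR]
        rfl
      rw [h2, h2]
      exact h1
    -- Data processing. The observation map depends on the instance only through β, which is common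
    -- to both, so a single map serves the two laws.
    have h3 := (ih.compProd hr (integrable_const _)).map
      (measurable_snoc_observe (signInstance K xbar Lbar θ ν) n)
    simp only [integral_const, probReal_univ, one_smul] at h3
    refine EntropyBound.mono h3 (le_of_eq ?_)
    push_cast
    ring

/-- Writing p for the probability of the slab, conditioning costs -log p ≤ p⁻¹ - 1 ≤ 2(1 - p), as p
≥ 1/2, and Chebyshev bounds this by 2|θ|²/b². The groups cost at most 2|θ|² ≤ 2|θ|²/b². -/
theorem entropyBound_slabLaw {b : ℝ} (hb : 0 < b) (hb1 : b ≤ 1)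
    (hq : (signLaw d).real (slab θ b)ᶜ ≤ 1 / 24) [IsProbabilityMeasure (slabLaw θ b)] (σ : ℝ≥0)
    (π : Policy K d) (n : ℕ) :
    EntropyBound (histLaw (signInstance K xbar Lbar θ (slabLaw θ b)) σ π n)
      (histLaw (signInstance K xbar Lbar 0 (signLaw d)) σ π n)
      (n * (4 * (∑ i, θ i ^ 2) / b ^ 2)) := by
  have hc := continuous_dotProduct_left θ
  have h : EntropyBound (slabLaw θ b) (signLaw d) (-Real.log ((signLaw d).real (slab θ b))) :=
    EntropyBound.cond _ (signLaw_slab_ne_zero hq)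
  refine (entropyBound_histLaw σ π h (integrable_slabLaw (by fun_prop) hq) n).mono
    (mul_le_mul_of_nonneg_left ?_ (Nat.cast_nonneg n))
  have h0 : 0 ≤ ∑ i, θ i ^ 2 := Finset.sum_nonneg fun i _ => sq_nonneg _
  have h1 := half_le_signLaw_real_slab hq
  have h2 := integral_slabLaw_sq_le θ hq
  have h3 := signLaw_real_slab_compl_le θ hb
  have h4 := signLaw_real_slab θ b
  have hp1 : (signLaw d).real (slab θ b) ≤ 1 := measureReal_le_one
  set p := (signLaw d).real (slab θ b)
  have h5 : -Real.log p ≤ 2 * ((∑ i, θ i ^ 2) / b ^ 2) := by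
    have h6 := Real.one_sub_inv_le_log_of_pos (show 0 < p by linarith)
    have h7 : p⁻¹ - 1 ≤ 2 * (1 - p) := by
      rw [inv_eq_one_div, div_sub_one (by linarith), div_le_iff₀ (by linarith)]
      nlinarith
    linarith
  have h8 : ∑ i, θ i ^ 2 ≤ (∑ i, θ i ^ 2) / b ^ 2 :=
    le_div_self h0 (by positivity) (pow_le_one₀ hb.le hb1)
  have h9 : 4 * (∑ i, θ i ^ 2) / b ^ 2 = 4 * ((∑ i, θ i ^ 2) / b ^ 2) := by ring
  linarith

end HistoryEntropy

/-! ### One spike in each block -/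

section Spikes

/-- For x ≥ 0, cosh x - 1 = (e^x - 1)² e^{-x}/2 and e^x - 1 ≤ x e^x. -/
theorem cosh_sub_one_le {x t : ℝ} (hx : |x| ≤ t) : Real.cosh x - 1 ≤ x ^ 2 * Real.exp t / 2 := by
  wlog h0 : 0 ≤ x generalizing x
  · have := @this (-x) (by simpa using hx) (by linarith)
    simpa using this
  rw [abs_of_nonneg h0] at hx
  have h1 : Real.cosh x - 1 = (Real.exp x - 1) ^ 2 * Real.exp (-x) / 2 := by
    rw [Real.cosh_eq]
    have : Real.exp x * Real.exp (-x) = 1 := by rw [← Real.exp_add]; simp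
    linear_combination (-(Real.exp x) / 2 + 1) * this
  have h2 : Real.exp x - 1 ≤ x * Real.exp x := by
    have h3 := Real.add_one_le_exp (-x)
    have h4 : Real.exp x * Real.exp (-x) = 1 := by rw [← Real.exp_add]; simp
    nlinarith [Real.exp_pos x]
  have h5 : 0 ≤ Real.exp x - 1 := by linarith [Real.add_one_le_exp x]
  have h6 : (Real.exp x - 1) ^ 2 ≤ (x * Real.exp x) ^ 2 := pow_le_pow_left₀ h5 h2 2
  have h7 : (x * Real.exp x) ^ 2 * Real.exp (-x) = x ^ 2 * Real.exp x := by
    have h4 : Real.exp x * Real.exp (-x) = 1 := by rw [← Real.exp_add]; simp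
    linear_combination x ^ 2 * Real.exp x * h4
  have h8 : x ^ 2 * Real.exp x ≤ x ^ 2 * Real.exp t :=
    mul_le_mul_of_nonneg_left (Real.exp_le_exp.2 hx) (sq_nonneg x)
  rw [h1]
  have := mul_le_mul_of_nonneg_right h6 (Real.exp_pos (-x)).le
  linarith

/-- The sign of a bit. -/
def bitSign (e : Bool) : ℝ := if e then 1 else -1

theorem abs_bitSign (e : Bool) : |bitSign e| = 1 := by cases e <;> simp [bitSign]

theorem bitSign_mul_self (e : Bool) : bitSign e * bitSign e = 1 := by cases e <;> simp [bitSign]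

variable {d s m : ℕ}

/-- The vector with entries `± η` at one position of each block; the positions of block `b` are
`pos (b, ·)`. -/
def spikes (pos : Fin s × Fin m → Fin d) (η : ℝ) (ω : Fin s → Fin m × Bool) : Fin d → ℝ :=
  ∑ b, Pi.single (pos (b, (ω b).1)) (η * bitSign (ω b).2)

theorem dotProduct_spikes (pos : Fin s × Fin m → Fin d) (η : ℝ) (ω : Fin s → Fin m × Bool)
    (w : Fin d → ℝ) :
    w ⬝ᵥ spikes pos η ω = η * ∑ b, bitSign (ω b).2 * w (pos (b, (ω b).1)) := by
  rw [spikes, dotProduct_sum, Finset.mul_sum]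
  refine Finset.sum_congr rfl fun b _ => ?_
  rw [dotProduct_single]
  ring

theorem spikes_apply {pos : Fin s × Fin m → Fin d} (hpos : Function.Injective pos) (η : ℝ)
    (ω : Fin s → Fin m × Bool) (b : Fin s) :
    spikes pos η ω (pos (b, (ω b).1)) = η * bitSign (ω b).2 := by
  rw [spikes, Finset.sum_apply, Finset.sum_eq_single b]
  · simp
  · intro b' _ hb'
    refine Pi.single_eq_of_ne (fun h => hb' ?_) _
    exact (Prod.ext_iff.1 (hpos h)).1.symm
  · simp

theorem sum_spikes_sq {pos : Fin s × Fin m → Fin d} (hpos : Function.Injective pos) (η : ℝ)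
    (ω : Fin s → Fin m × Bool) : ∑ i, spikes pos η ω i ^ 2 = s * η ^ 2 := by
  have h : ∑ i, spikes pos η ω i ^ 2 = spikes pos η ω ⬝ᵥ spikes pos η ω := by
    simp [dotProduct, sq]
  rw [h, dotProduct_spikes]
  simp only [spikes_apply hpos]
  have h2 : ∀ b, bitSign (ω b).2 * (η * bitSign (ω b).2) = η := fun b => by
    linear_combination η * bitSign_mul_self (ω b).2
  simp only [h2, Finset.sum_const, Finset.card_univ, Fintype.card_fin, nsmul_eq_mul]
  ring

theorem isSparse_spikes (pos : Fin s × Fin m → Fin d) (η : ℝ) (ω : Fin s → Fin m × Bool) :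
    IsSparse s (spikes pos η ω) := by
  have h : (Finset.univ.filter fun j => spikes pos η ω j ≠ 0) ⊆
      Finset.univ.image fun b => pos (b, (ω b).1) := by
    intro j hj
    rw [Finset.mem_filter] at hj
    by_contra hne
    refine hj.2 ?_
    rw [spikes, Finset.sum_apply]
    refine Finset.sum_eq_zero fun b _ => Pi.single_eq_of_ne (fun h => hne ?_) _
    exact Finset.mem_image.2 ⟨b, Finset.mem_univ _, h.symm⟩
  refine (Finset.card_le_card h).trans (Finset.card_image_le.trans ?_)
  simp

/-- The exponential factors over the blocks. In one block the mean over the 2m choices is the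
average of cosh over the m positions, at most 1 + e^t (Σ x²)/(2m). Spreading a bounded total Σ x²
over many positions is what makes this small. -/
theorem sum_exp_spikes_le (hm : 0 < m) {t v : ℝ} {x : Fin s × Fin m → ℝ}
    (hx : ∀ p, |x p| ≤ t) (hv : ∑ p, x p ^ 2 ≤ v) :
    ∑ ω : Fin s → Fin m × Bool, Real.exp (∑ b, bitSign (ω b).2 * x (b, (ω b).1)) ≤
      Fintype.card (Fin s → Fin m × Bool) * Real.exp (v * Real.exp t / (2 * m)) := by
  have hm' : (0 : ℝ) < m := Nat.cast_pos.2 hm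
  simp only [Real.exp_sum]
  rw [← Fintype.prod_sum (κ := fun _ : Fin s => Fin m × Bool)
    (f := fun b p => Real.exp (bitSign p.2 * x (b, p.1)))]
  have h1 : ∀ b, ∑ p : Fin m × Bool, Real.exp (bitSign p.2 * x (b, p.1)) ≤
      (2 * m) * Real.exp ((∑ j, x (b, j) ^ 2) * Real.exp t / (2 * m)) := by
    intro b
    have h2 : ∑ p : Fin m × Bool, Real.exp (bitSign p.2 * x (b, p.1)) =
        ∑ j, 2 * Real.cosh (x (b, j)) := by
      rw [Fintype.sum_prod_type]
      refine Finset.sum_congr rfl fun j _ => ?_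
      rw [Fintype.sum_bool, Real.cosh_eq]
      simp [bitSign]
      ring
    rw [h2]
    calc ∑ j, 2 * Real.cosh (x (b, j)) ≤ ∑ j, (2 + x (b, j) ^ 2 * Real.exp t) :=
          Finset.sum_le_sum fun j _ => by linarith [cosh_sub_one_le (hx (b, j))]
      _ = (2 * m) * ((∑ j, x (b, j) ^ 2) * Real.exp t / (2 * m) + 1) := by
          rw [Finset.sum_add_distrib, ← Finset.sum_mul]
          simp only [Finset.sum_const, Finset.card_univ, Fintype.card_fin, nsmul_eq_mul]
          field_simp
          ring
      _ ≤ _ := mul_le_mul_of_nonneg_left (Real.add_one_le_exp _) (by positivity)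
  refine (Finset.prod_le_prod (fun b _ => Finset.sum_nonneg fun p _ => (Real.exp_pos _).le)
    fun b _ => h1 b).trans ?_
  rw [Finset.prod_mul_distrib, ← Real.exp_sum]
  simp only [Finset.prod_const, Finset.card_univ, Fintype.card_fin, Fintype.card_pi,
    Fintype.card_prod, Fintype.card_bool]
  push_cast
  rw [mul_comm (m : ℝ) 2]
  refine mul_le_mul_of_nonneg_left (Real.exp_le_exp.2 ?_) (by positivity)
  rw [← Finset.sum_div, ← Finset.sum_mul, ← Fintype.sum_prod_type (f := fun p => x p ^ 2)]
  gcongr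

/-- A statistic `w` of Euclidean length at most one has small correlation with the spikes, if the
relative entropies are small. -/
theorem sum_integral_dotProduct_spikes_le {α : Type*} [MeasurableSpace α] (hs : 0 < s)
    (hm : 0 < m) {pos : Fin s × Fin m → Fin d} (hpos : Function.Injective pos) {η : ℝ}
    (hη : 0 < η) {P : (Fin s → Fin m × Bool) → Measure α} {Q : Measure α}
    [∀ ω, IsProbabilityMeasure (P ω)] [IsProbabilityMeasure Q] {k : ℝ}
    (h : ∀ ω, EntropyBound (P ω) Q k) {w : α → Fin d → ℝ} (hw : Measurable w)
    (hw1 : ∀ a, ∑ j, w a j ^ 2 ≤ 1) {B : ℝ} (hB : 0 < B) :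
    ∑ ω, ∫ a, w a ⬝ᵥ spikes pos η ω ∂(P ω) ≤ Fintype.card (Fin s → Fin m × Bool) *
      (η * √s * (2 / B + 2 * B * k / (s * Real.log (2 * m)))) := by
  have hs' : (0 : ℝ) < s := Nat.cast_pos.2 hs
  have hm' : (1 : ℝ) ≤ m := Nat.one_le_cast.2 hm
  have : Nonempty (Fin m) := ⟨⟨0, hm⟩⟩
  have hsq : 0 < √(s : ℝ) := Real.sqrt_pos.2 hs'
  have hss : √(s : ℝ) * √s = s := Real.mul_self_sqrt hs'.le
  set N : ℝ := 2 * m with hN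
  have hN2 : 2 ≤ N := by rw [hN]; linarith
  -- The largest tilt allowed per coordinate. With e^t = √N the loss e^t in the cosh bound uses up
  -- only half of the 1/N gained from averaging over the block.
  set t : ℝ := Real.log (√N) with ht
  have htN : Real.log N = 2 * t := by rw [ht, Real.log_sqrt (by linarith)]; ring
  have hlog : 0 < Real.log N := Real.log_pos (by linarith)
  have ht0 : 0 < t := by linarith
  have hexp : Real.exp t = √N := Real.exp_log (Real.sqrt_pos.2 (by linarith))
  have htle : t ≤ √N := by
    have := Real.add_one_le_exp t
    linarith
  -- The truncation level: a vector of length at most one exceeds ρ in at most s/B² coordinates.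
  set ρ : ℝ := B / √s with hρ
  have hρ0 : 0 < ρ := by positivity
  have hwj : ∀ j, Measurable fun a => w a j := fun j => (measurable_pi_apply j).comp hw
  have hwle : ∀ a j, |w a j| ≤ 1 := fun a j => by
    rw [← sq_le_one_iff_abs_le_one]
    exact (Finset.single_le_sum (f := fun j => w a j ^ 2) (fun i _ => sq_nonneg _)
      (Finset.mem_univ j)).trans (hw1 a)
  set y : α → Fin s × Fin m → ℝ := fun a p =>
    if |w a (pos p)| ≤ ρ then w a (pos p) else 0 with hy
  have hym : ∀ p, Measurable fun a => y a p := fun p =>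
    Measurable.ite (measurableSet_le (hwj _).abs measurable_const) (hwj _) measurable_const
  have hyρ : ∀ a p, |y a p| ≤ ρ := fun a p => by
    simp only [hy]; split_ifs with h
    · exact h
    · simpa using hρ0.le
  have hysq : ∀ a, ∑ p, y a p ^ 2 ≤ 1 := fun a => by
    refine le_trans ?_ (hw1 a)
    calc ∑ p, y a p ^ 2 ≤ ∑ p, w a (pos p) ^ 2 := Finset.sum_le_sum fun p _ => by
          simp only [hy]; split_ifs
          · exact le_rfl
          · simpa using sq_nonneg _
      _ = ∑ j ∈ Finset.univ.map ⟨pos, hpos⟩, w a j ^ 2 := by rw [Finset.sum_map]; rfl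
      _ ≤ _ := Finset.sum_le_sum_of_subset_of_nonneg (Finset.subset_univ _)
          fun _ _ _ => sq_nonneg _
  -- A coordinate removed by the truncation satisfies |w| ≤ w²/ρ, so all of them together cost at
  -- most 1/ρ.
  have hydiff : ∀ a p (e : Bool), bitSign e * w a (pos p) ≤
      bitSign e * y a p + w a (pos p) ^ 2 / ρ := fun a p e => by
    simp only [hy]; split_ifs with h
    · have : 0 ≤ w a (pos p) ^ 2 / ρ := by positivity
      linarith
    · have h1 : bitSign e * w a (pos p) ≤ |w a (pos p)| := by
        refine (le_abs_self _).trans ?_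
        rw [abs_mul, abs_bitSign, one_mul]
      have h2 : |w a (pos p)| ≤ w a (pos p) ^ 2 / ρ := by
        rw [le_div_iff₀ hρ0, ← sq_abs]
        nlinarith [abs_nonneg (w a (pos p))]
      linarith
  set F : (Fin s → Fin m × Bool) → α → ℝ := fun ω a =>
    ∑ b, bitSign (ω b).2 * (t / ρ * y a (b, (ω b).1)) with hF
  have hFm : ∀ ω, Measurable (F ω) := fun ω =>
    Finset.measurable_sum _ fun b _ => ((hym _).const_mul _).const_mul _
  have hxt : ∀ a p, |t / ρ * y a p| ≤ t := fun a p => by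
    rw [abs_mul, abs_of_pos (by positivity), div_mul_eq_mul_div, div_le_iff₀ hρ0]
    exact mul_le_mul_of_nonneg_left (hyρ a p) ht0.le
  have hFC : ∀ ω a, |F ω a| ≤ s * t := fun ω a => by
    refine (Finset.abs_sum_le_sum_abs _ _).trans ?_
    have : ∀ b ∈ Finset.univ, |bitSign (ω b).2 * (t / ρ * y a (b, (ω b).1))| ≤ t :=
      fun b _ => by rw [abs_mul, abs_bitSign, one_mul]; exact hxt a _
    exact (Finset.sum_le_card_nsmul _ _ _ this).trans (by simp)
  -- The mean of exp F over the spikes is at most exp(t²/(ρ²√N)), and t ≤ √N turns the exponent into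
  -- at most t/ρ².
  have hsum := EntropyBound.sum_le h hFm hFC (c := t / ρ ^ 2) fun a => by
    refine (sum_exp_spikes_le hm (x := fun p => t / ρ * y a p) (hxt a) (v := (t / ρ) ^ 2)
      ?_).trans ?_
    · simp only [mul_pow, ← Finset.mul_sum]
      exact mul_le_of_le_one_right (sq_nonneg _) (hysq a)
    · refine mul_le_mul_of_nonneg_left (Real.exp_le_exp.2 ?_) (by positivity)
      rw [← hN, hexp, div_pow, div_mul_eq_mul_div, div_div, div_le_div_iff₀ (by positivity)
        (by positivity)]
      have h1 : √N * √N = N := Real.mul_self_sqrt (by linarith)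
      have h2 : t ^ 2 * √N ≤ t * N := by
        have := mul_le_mul_of_nonneg_right htle (mul_nonneg ht0.le (Real.sqrt_nonneg N))
        calc t ^ 2 * √N = t * (t * √N) := by ring
          _ ≤ √N * (t * √N) := this
          _ = t * (√N * √N) := by ring
          _ = t * N := by rw [h1]
      nlinarith [mul_le_mul_of_nonneg_right h2 (sq_nonneg ρ)]
  have hone : ∀ ω, ∫ a, w a ⬝ᵥ spikes pos η ω ∂(P ω) ≤
      η * (ρ / t * ∫ a, F ω a ∂(P ω)) + η / ρ := fun ω => by
    have h1 : ∀ a, w a ⬝ᵥ spikes pos η ω ≤ η * (ρ / t * F ω a) + η / ρ := fun a => by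
      rw [dotProduct_spikes]
      have h2 : ∑ b, bitSign (ω b).2 * w a (pos (b, (ω b).1)) ≤
          ∑ b, (bitSign (ω b).2 * y a (b, (ω b).1) + w a (pos (b, (ω b).1)) ^ 2 / ρ) :=
        Finset.sum_le_sum fun b _ => hydiff a _ _
      have h3 : ∑ b, w a (pos (b, (ω b).1)) ^ 2 ≤ 1 := by
        refine le_trans ?_ (hw1 a)
        have hinj : Function.Injective fun b => pos (b, (ω b).1) := fun b b' hb =>
          (Prod.ext_iff.1 (hpos hb)).1
        calc ∑ b, w a (pos (b, (ω b).1)) ^ 2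
            = ∑ j ∈ Finset.univ.map ⟨_, hinj⟩, w a j ^ 2 := by rw [Finset.sum_map]; rfl
          _ ≤ _ := Finset.sum_le_sum_of_subset_of_nonneg (Finset.subset_univ _)
            fun _ _ _ => sq_nonneg _
      have h4 : ρ / t * F ω a = ∑ b, bitSign (ω b).2 * y a (b, (ω b).1) := by
        simp only [hF, Finset.mul_sum]
        refine Finset.sum_congr rfl fun b _ => ?_
        field_simp
      rw [Finset.sum_add_distrib, ← Finset.sum_div, ← h4] at h2
      have h5 : (∑ b, w a (pos (b, (ω b).1)) ^ 2) / ρ ≤ 1 / ρ :=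
        div_le_div_of_nonneg_right h3 hρ0.le
      calc _ ≤ η * (ρ / t * F ω a + 1 / ρ) := mul_le_mul_of_nonneg_left (by linarith) hη.le
        _ = _ := by ring
    have hFi : Integrable (F ω) (P ω) := integrable_of_abs_le (hFm ω) (hFC ω)
    have hwi : Integrable (fun a => w a ⬝ᵥ spikes pos η ω) (P ω) := by
      simp only [dotProduct]
      exact integrable_finsetSum _ fun j _ =>
        (integrable_of_abs_le (hwj j) fun a => hwle a j).mul_const _
    have h6 := integral_mono hwi (((hFi.const_mul (ρ / t)).const_mul η).add
      (integrable_const (η / ρ))) h1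
    simp only [Pi.add_apply] at h6
    rw [integral_add ((hFi.const_mul (ρ / t)).const_mul η) (integrable_const _),
      integral_const_mul, integral_const_mul] at h6
    simpa using h6
  refine (Finset.sum_le_sum fun ω _ => hone ω).trans ?_
  rw [Finset.sum_add_distrib, ← Finset.mul_sum, ← Finset.mul_sum]
  simp only [Finset.sum_const, Finset.card_univ, nsmul_eq_mul]
  set c : ℝ := (Fintype.card (Fin s → Fin m × Bool) : ℝ) with hc
  calc η * (ρ / t * ∑ ω, ∫ a, F ω a ∂(P ω)) + c * (η / ρ)
      ≤ η * (ρ / t * (c * (k + t / ρ ^ 2))) + c * (η / ρ) := by gcongr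
    _ = c * (η * (ρ * k / t + 2 / ρ)) := by
        field_simp
        ring
    _ = _ := by
        rw [htN, hρ, mul_assoc η]
        congr 2
        generalize √(s : ℝ) = r at *
        rw [← hss]
        field_simp
        ring

end Spikes

end

section

/-! ### The regular regret on the slab instances -/

section RegularRegret

variable {K d : ℕ} [NeZero K] [NeZero d] {xbar Lbar : ℝ}

/-- The coordinates of the response of a policy with respect to the random signs. -/
def responseCoord (π : Policy K d) (xbar : ℝ) (n : ℕ) (h : Hist K d n) (j : Fin d) : ℝ :=
  ∫ r, r j * response π xbar n h r ∂signLaw d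

theorem measurable_responseCoord (π : Policy K d) (xbar : ℝ) (n : ℕ) :
    Measurable (responseCoord π xbar n) := by
  refine measurable_pi_lambda _ fun j => ?_
  have hm : Measurable fun q : Hist K d n × (Fin d → ℝ) => q.2 j * response π xbar n q.1 q.2 :=
    ((measurable_pi_apply j).comp measurable_snd).mul (measurable_response π xbar n)
  exact (hm.stronglyMeasurable.integral_prod_right' (ν := signLaw d)).measurable

theorem sum_responseCoord_sq_le (π : Policy K d) (xbar : ℝ) (n : ℕ) (h : Hist K d n) :
    ∑ j, responseCoord π xbar n h j ^ 2 ≤ 1 :=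
  sum_integral_mul_sq_le ((measurable_response π xbar n).comp measurable_prodMk_left)
    fun r => abs_response_le π xbar n h r

theorem integral_dotProduct_mul_response (π : Policy K d) (xbar : ℝ) (n : ℕ) (h : Hist K d n)
    (θ : Fin d → ℝ) : ∫ r, (r ⬝ᵥ θ) * response π xbar n h r ∂signLaw d =
      responseCoord π xbar n h ⬝ᵥ θ := by
  have hm : Measurable fun r => response π xbar n h r :=
    (measurable_response π xbar n).comp measurable_prodMk_left
  simp only [dotProduct, Finset.sum_mul]
  rw [integral_finsetSum]
  · refine Finset.sum_congr rfl fun j _ => ?_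
    rw [responseCoord, ← integral_mul_const]
    exact integral_congr_ae (ae_of_all _ fun r => by dsimp only; ring)
  · intro j _
    exact (integrable_signLaw (f := fun r => r j * θ j) (by fun_prop)).mul_bdd (c := 1)
      hm.aestronglyMeasurable (ae_of_all _ fun r => by
        simpa [Real.norm_eq_abs] using abs_response_le π xbar n h r)

/-- On the slab |⟨z, θ⟩| ≤ 1, so the bias may be replaced by a quarter of ⟨z, θ⟩. Passing to the
unconditioned signs loses 2δ²/b, and there the benchmark is at least δ/3. -/
theorem le_integral_instantRegular (hK : 2 ≤ K) (hx : 0 < xbar) (hL : 0 < Lbar)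
    {θ : Fin d → ℝ} {b δ : ℝ} (hb : 0 < b) (hb1 : b ≤ 1) (hδ : 0 < δ)
    (hθ : ∑ i, θ i ^ 2 = δ ^ 2) (hq : (signLaw d).real (slab θ b)ᶜ ≤ 1 / 24)
    [IsProbabilityMeasure (slabLaw θ b)] (σ : ℝ≥0) (π : Policy K d) (n : ℕ) :
    xbar * Lbar / 4 * (δ / 3 - 2 * δ ^ 2 / b -
        ∫ h, responseCoord π xbar n h ⬝ᵥ θ
          ∂histLaw (signInstance K xbar Lbar θ (slabLaw θ b)) σ π n) ≤
      ∫ w, instantRegular (signInstance K xbar Lbar θ (slabLaw θ b)) w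
        ∂roundLaw (signInstance K xbar Lbar θ (slabLaw θ b)) σ π n := by
  have ht : 0 < xbar * Lbar := mul_pos hx hL
  have hc := continuous_dotProduct_left θ
  rw [integral_instantRegular σ π n hK hx hL, mul_comm_div]
  refine mul_le_mul_of_nonneg_left ?_ ht.le
  set P := histLaw (signInstance K xbar Lbar θ (slabLaw θ b)) σ π n
  have hround : ∀ h : Hist K d n, (δ / 3 - 2 * δ ^ 2 / b - responseCoord π xbar n h ⬝ᵥ θ) / 4 ≤
      ∫ z, (|groupBias (z ⬝ᵥ θ)| - groupBias (z ⬝ᵥ θ) * response π xbar n h z)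
        ∂slabLaw θ b := fun h => by
    have hm : Measurable fun r => response π xbar n h r :=
      (measurable_response π xbar n).comp measurable_prodMk_left
    have h1 := sub_le_integral_slabLaw (θ := θ) hm (fun r => abs_response_le π xbar n h r) hb hq
    rw [integral_dotProduct_mul_response, hθ] at h1
    have h2 := div_three_le_integral_signLaw_abs hδ hθ
    have h3 : ∫ z, (|z ⬝ᵥ θ| - (z ⬝ᵥ θ) * response π xbar n h z) / 4 ∂slabLaw θ b ≤
        ∫ z, (|groupBias (z ⬝ᵥ θ)| - groupBias (z ⬝ᵥ θ) * response π xbar n h z)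
        ∂slabLaw θ b := by
      refine integral_mono_ae (Integrable.div_const ((integrable_slabLaw (by fun_prop) hq).sub
        ((integrable_slabLaw hc hq).mul_bdd (c := 1) hm.aestronglyMeasurable
          (ae_of_all _ fun r => by
            simpa [Real.norm_eq_abs] using abs_response_le π xbar n h r))) 4)
        (integrable_abs_groupBias.sub (integrable_groupBias_mul_response π n h)) ?_
      filter_upwards [ae_slabLaw_mem] with z hz
      exact abs_sub_mul_le_groupBias (le_trans hz hb1) (abs_response_le π xbar n h z)
    rw [integral_div] at h3
    linarith
  have hcoord : Integrable (fun h => responseCoord π xbar n h ⬝ᵥ θ) P := by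
    simp only [dotProduct]
    refine integrable_finsetSum _ fun j _ => (integrable_of_abs_le (C := 1)
      ((measurable_pi_apply j).comp (measurable_responseCoord π xbar n)) fun h => ?_).mul_const _
    rw [← sq_le_one_iff_abs_le_one]
    exact (Finset.single_le_sum (f := fun j => responseCoord π xbar n h j ^ 2)
      (fun i _ => sq_nonneg _) (Finset.mem_univ j)).trans (sum_responseCoord_sq_le π xbar n h)
  have hright : Integrable (fun h => ∫ z, (|groupBias (z ⬝ᵥ θ)| -
      groupBias (z ⬝ᵥ θ) * response π xbar n h z) ∂slabLaw θ b) P := by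
    have h4 : ∀ h : Hist K d n, ∫ z, (|groupBias (z ⬝ᵥ θ)| -
        groupBias (z ⬝ᵥ θ) * response π xbar n h z) ∂slabLaw θ b =
        (∫ z, |groupBias (z ⬝ᵥ θ)| ∂slabLaw θ b) -
          ∫ z, groupBias (z ⬝ᵥ θ) * response π xbar n h z ∂slabLaw θ b :=
      fun h => integral_sub integrable_abs_groupBias (integrable_groupBias_mul_response π n h)
    simp only [h4]
    exact (integrable_const _).sub (integrable_integral_groupBias_mul_response π n P)
  have h5 := integral_mono (((integrable_const _).sub hcoord).div_const 4) hright hround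
  simp only [Pi.sub_apply] at h5
  rw [integral_div, integral_sub (integrable_const _) hcoord] at h5
  simpa using h5

/-- For each policy, one of the spike vectors makes the regular regret large. -/
theorem exists_le_regularRegret (hK : 2 ≤ K) (hx : 0 < xbar) (hL : 0 < Lbar) {s m T : ℕ}
    (hs : 0 < s) (hm : 0 < m) {pos : Fin s × Fin m → Fin d}
    (hpos : Function.Injective pos) {b η : ℝ} (hb : 0 < b) (hb1 : b ≤ 1) (hη : 0 < η)
    (hηT : 4608 * (η ^ 2 * T) ≤ b ^ 2 * Real.log (2 * m)) (hηb : 48 * (η * √s) ≤ b)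
    [∀ ω, IsProbabilityMeasure (slabLaw (spikes pos η ω) b)]
    (hq : ∀ ω, (signLaw d).real (slab (spikes pos η ω) b)ᶜ ≤ 1 / 24)
    (σ : ℝ≥0) (π : Policy K d) :
    ∃ ω, xbar * Lbar / 24 * (T * (η * √s)) ≤ regularRegret
      (signInstance K xbar Lbar (spikes pos η ω) (slabLaw (spikes pos η ω) b)) σ π T := by
  have ht : 0 < xbar * Lbar := mul_pos hx hL
  have hs' : (0 : ℝ) < s := Nat.cast_pos.2 hs
  have hm' : (1 : ℝ) ≤ m := Nat.one_le_cast.2 hm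
  have : Nonempty (Fin m) := ⟨⟨0, hm⟩⟩
  have hlog : 0 < Real.log (2 * m) := Real.log_pos (by linarith)
  have hsq : √(s : ℝ) ^ 2 = s := Real.sq_sqrt hs'.le
  have hδ : 0 < η * √s := by positivity
  have hsum : ∀ ω, ∑ i, spikes pos η ω i ^ 2 = (η * √s) ^ 2 := fun ω => by
    rw [sum_spikes_sq hpos, mul_pow, hsq, mul_comm]
  set δ := η * √s with hδdef
  set P : ∀ (n : ℕ) (ω : Fin s → Fin m × Bool), Measure (Hist K d n) := fun n ω =>
    histLaw (signInstance K xbar Lbar (spikes pos η ω) (slabLaw (spikes pos η ω) b)) σ π n with hP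
  set N : ℝ := (Fintype.card (Fin s → Fin m × Bool) : ℝ) with hN
  have hround : ∀ n ∈ Finset.range T, N * (xbar * Lbar / 24 * δ) ≤
      ∑ ω, ∫ w, instantRegular
        (signInstance K xbar Lbar (spikes pos η ω) (slabLaw (spikes pos η ω) b)) w
        ∂roundLaw (signInstance K xbar Lbar (spikes pos η ω) (slabLaw (spikes pos η ω) b))
          σ π n := by
    intro n hn
    have hnT : (n : ℝ) ≤ T := Nat.cast_le.2 (Finset.mem_range.1 hn).le
    have h1 := sum_integral_dotProduct_spikes_le hs hm hpos hη (P := P n)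
      (Q := histLaw (signInstance K xbar Lbar 0 (signLaw d)) σ π n)
      (k := n * (4 * δ ^ 2 / b ^ 2)) (fun ω => by
        have := entropyBound_slabLaw (K := K) (xbar := xbar) (Lbar := Lbar) hb hb1 (hq ω) σ π n
        rwa [hsum] at this) (measurable_responseCoord π xbar n)
      (sum_responseCoord_sq_le π xbar n) (B := 24) (by norm_num)
    rw [← hN, ← hδdef] at h1
    -- The constant in the hypothesis on η is 4608 = 2 · 24 · 4 · 24: B = 24, the factor 4 of the
    -- entropy bound, and the target 1/24.
    have h2 : 2 * 24 * (n * (4 * δ ^ 2 / b ^ 2)) / (s * Real.log (2 * m)) ≤ 1 / 24 := by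
      rw [hδdef, mul_pow, hsq, div_le_div_iff₀ (by positivity) (by norm_num)]
      have h3 : η ^ 2 * n ≤ η ^ 2 * T := mul_le_mul_of_nonneg_left hnT (sq_nonneg η)
      have h4 : 4608 * (η ^ 2 * n) / b ^ 2 ≤ Real.log (2 * m) := by
        rw [div_le_iff₀ (by positivity)]
        linarith
      calc 2 * 24 * (n * (4 * (η ^ 2 * s) / b ^ 2)) * 24
          = s * (4608 * (η ^ 2 * n) / b ^ 2) := by ring
        _ ≤ s * Real.log (2 * m) := mul_le_mul_of_nonneg_left h4 hs'.le
        _ = _ := by ring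
    have h5 : 2 * δ ^ 2 / b ≤ δ / 24 := by
      rw [div_le_div_iff₀ hb (by norm_num)]
      nlinarith
    have h6 : ∑ ω, ∫ h, responseCoord π xbar n h ⬝ᵥ spikes pos η ω ∂P n ω ≤ N * (δ / 8) := by
      refine h1.trans (mul_le_mul_of_nonneg_left ?_ (Nat.cast_nonneg _))
      rw [show δ / 8 = δ * (1 / 12 + 1 / 24) by ring]
      refine mul_le_mul_of_nonneg_left ?_ hδ.le
      linarith
    refine le_trans ?_ (Finset.sum_le_sum fun ω _ =>
      le_integral_instantRegular hK hx hL hb hb1 hδ (hsum ω) (hq ω) σ π n)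
    rw [← Finset.mul_sum, Finset.sum_sub_distrib]
    simp only [Finset.sum_const, Finset.card_univ, nsmul_eq_mul]
    rw [← hN]
    -- The budget is 1/3 - 1/24 - 1/8 = 1/6: benchmark, slab correction, correlation.
    have h7 : N * (δ / 6) ≤ N * (δ / 3 - 2 * δ ^ 2 / b) -
        ∑ ω, ∫ h, responseCoord π xbar n h ⬝ᵥ spikes pos η ω ∂P n ω := by
      have h8 : N * (δ / 3 - δ / 24) ≤ N * (δ / 3 - 2 * δ ^ 2 / b) :=
        mul_le_mul_of_nonneg_left (by linarith) (Nat.cast_nonneg _)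
      linarith
    calc N * (xbar * Lbar / 24 * δ) = xbar * Lbar / 4 * (N * (δ / 6)) := by ring
      _ ≤ _ := mul_le_mul_of_nonneg_left h7 (by positivity)
  have htotal : ∑ _ω : Fin s → Fin m × Bool, xbar * Lbar / 24 * (T * δ) ≤
      ∑ ω, regularRegret
        (signInstance K xbar Lbar (spikes pos η ω) (slabLaw (spikes pos η ω) b)) σ π T := by
    simp only [regularRegret]
    rw [Finset.sum_comm]
    refine le_trans (le_of_eq ?_) (Finset.sum_le_sum hround)
    simp only [Finset.sum_const, Finset.card_univ, Finset.card_range, nsmul_eq_mul]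
    ring
  obtain ⟨ω, -, hω⟩ := Finset.exists_le_of_sum_le Finset.univ_nonempty htotal
  exact ⟨ω, hω⟩

end RegularRegret

/-! ### Parameters -/

/-- The group probability lies in `(ξ, 1 - ξ)` if the log-odds are smaller than those of `1 - ξ`. -/
theorem sigmoid_mem_of_abs_lt {ξ u : ℝ} (hξ : 0 < ξ) (hξ' : ξ < 1 / 2)
    (hu : |u| < Real.log ((1 - ξ) / ξ)) : ξ < Real.sigmoid u ∧ Real.sigmoid u < 1 - ξ := by
  have h1 : 0 < 1 - ξ := by linarith
  have hs : Real.sigmoid (Real.log ((1 - ξ) / ξ)) = 1 - ξ := by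
    rw [Real.sigmoid_def, Real.exp_neg, Real.exp_log (by positivity)]
    field_simp
    ring
  obtain ⟨h2, h3⟩ := abs_lt.1 hu
  have h4 := Real.sigmoid_strictMono h3
  have h5 := Real.sigmoid_strictMono h2
  rw [Real.sigmoid_neg, hs] at h5
  rw [hs] at h4
  exact ⟨by linarith, h4⟩

/-- The size of the spikes that is too small to be detected after `T` rounds. -/
theorem exists_spike_size {A b : ℝ} (hA : 0 < A) (hb : 0 < b) {d s T : ℕ} (hd : 2 ≤ d)
    (hs : 1 ≤ s) (hsd : s ≤ d) (hA1 : Real.log d ≤ A * Real.log (d / s))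
    (hA2 : s * Real.log d ≤ A * T) :
    ∃ η : ℝ, 0 < η ∧ 4608 * (η ^ 2 * T) ≤ b ^ 2 * Real.log (2 * (d / s : ℕ)) ∧
      48 * (η * √s) ≤ b ∧
      √(b ^ 2 / (4608 * (1 + A)) / A) * (√(s * Real.log d) * √T) ≤ T * (η * √s) := by
  -- The factor 1 + A serves two demands: 4608 c₁ ≤ b² for the information bound, and 4608 A c₁ ≤ b²
  -- for δ ≤ b/48.
  set c₁ : ℝ := b ^ 2 / (4608 * (1 + A)) with hc₁
  have hc₁0 : 0 < c₁ := by positivity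
  have hc₁eq : c₁ * (4608 * (1 + A)) = b ^ 2 := div_mul_cancel₀ _ (by positivity)
  set m := d / s with hmdef
  have hm : 0 < m := Nat.div_pos hsd hs
  have hs' : (0 : ℝ) < s := Nat.cast_pos.2 hs
  have hm' : (1 : ℝ) ≤ m := Nat.one_le_cast.2 hm
  have hd' : (2 : ℝ) ≤ d := by exact_mod_cast hd
  have hlogd : 0 < Real.log d := Real.log_pos (by linarith)
  have hT : (0 : ℝ) < T := by
    by_contra hT
    have h1 : A * T ≤ 0 := mul_nonpos_of_nonneg_of_nonpos hA.le (not_lt.1 hT)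
    have h2 : 0 < s * Real.log d := by positivity
    linarith
  have hlogN : 0 < Real.log (2 * m) := Real.log_pos (by linarith)
  have hNd : Real.log (2 * m) ≤ 2 * Real.log d := by
    have h1 : (m : ℝ) ≤ d := by exact_mod_cast Nat.div_le_self d s
    rw [← Real.log_rpow (by linarith)]
    refine Real.log_le_log (by linarith) ?_
    norm_num
    nlinarith
  -- The rounding in m = ⌊d/s⌋ is harmless because d/s < m + 1 ≤ 2m.
  have hdN : Real.log d ≤ A * Real.log (2 * m) := by
    refine hA1.trans (mul_le_mul_of_nonneg_left (Real.log_le_log (by positivity) ?_) hA.le)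
    rw [div_le_iff₀ hs']
    have h1 : d < s * (m + 1) := Nat.lt_mul_div_succ d hs
    have h2 : (d : ℝ) < s * (m + 1) := by exact_mod_cast h1
    nlinarith
  set η : ℝ := √(c₁ * Real.log (2 * m) / T) with hη
  have hη0 : 0 < η := by positivity
  have hη2 : η ^ 2 * T = c₁ * Real.log (2 * m) := by
    rw [hη, Real.sq_sqrt (by positivity)]
    field_simp
  have hsq : √(s : ℝ) ^ 2 = s := Real.sq_sqrt hs'.le
  have hc₁b : 4608 * c₁ ≤ b ^ 2 := by nlinarith
  have hηs : (48 * (η * √s)) ^ 2 ≤ b ^ 2 := by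
    have h1 : (48 * (η * √s)) ^ 2 * T = 2304 * c₁ * (s * Real.log (2 * m)) := by
      rw [mul_pow, mul_pow, hsq]
      linear_combination 48 ^ 2 * s * hη2
    have h2 : s * Real.log (2 * m) ≤ 2 * (A * T) := by
      have := mul_le_mul_of_nonneg_left hNd hs'.le
      linarith
    have h3 : 2304 * c₁ * (s * Real.log (2 * m)) ≤ b ^ 2 * T := by
      have := mul_le_mul_of_nonneg_left h2 hc₁0.le
      rw [← hc₁eq]
      linarith [mul_pos hc₁0 hT]
    rw [← h1] at h3
    exact le_of_mul_le_mul_right h3 hT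
  have hηb : 48 * (η * √s) ≤ b := (pow_le_pow_iff_left₀ (by positivity) hb.le two_ne_zero).1 hηs
  refine ⟨η, hη0, by rw [hη2, ← mul_assoc]; exact mul_le_mul_of_nonneg_right hc₁b hlogN.le,
    hηb, ?_⟩
  rw [← Real.sqrt_mul (by positivity), ← Real.sqrt_mul (by positivity)]
  refine Real.sqrt_le_iff.2 ⟨by positivity, ?_⟩
  have h1 : (T * (η * √s)) ^ 2 = c₁ * Real.log (2 * m) * (s * T) := by
    rw [mul_pow, mul_pow, hsq]
    linear_combination (s : ℝ) * T * hη2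
  rw [h1, div_mul_eq_mul_div, div_le_iff₀ hA]
  have h2 := mul_le_mul_of_nonneg_left hdN (show 0 ≤ c₁ * (s * T) by positivity)
  linarith


theorem inClass_slabLaw {K d : ℕ} [NeZero K] [NeZero d] {xbar Lbar : ℝ} {θ : Fin d → ℝ} {b : ℝ}
    {s : ℕ} {ξ M κ C hbar : ℝ} (hK : 2 ≤ K) (hs : 1 ≤ s) (hx : 0 < xbar) (hL : 0 < Lbar)
    (hξ : 0 < ξ) (hξ' : ξ < 1 / 2) (hb : b < Real.log ((1 - ξ) / ξ))
    (hM1 : xbar ^ 2 < M) (hM2 : 4 / xbar ^ 2 < M) (hM : 4 ≤ M) (hκ : 2 * xbar + 2 ≤ κ)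
    (hC : 0 < C) (hh : hbar ≤ xbar * Lbar / 4) (hθ : IsSparse s θ)
    (hq : (signLaw d).real (slab θ b)ᶜ ≤ 1 / 24) [IsProbabilityMeasure (slabLaw θ b)] :
    InClass s xbar Lbar ξ M κ C hbar (signInstance K xbar Lbar θ (slabLaw θ b)) := by
  refine inClass_signInstance (κz := 2) hK hs hx hL (by linarith) hM1 hM2 (by norm_num) hκ hC hh
    hθ ?_ (fun u hu => lintegral_slabLaw_exp_sq_le hu hq) (eigenvaluesWithin_slabLaw hM hq)
  filter_upwards [ae_slabLaw_mem] with z hz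
  exact sigmoid_mem_of_abs_lt hξ hξ' (lt_of_le_of_lt hz hb)

end

end LatentBandit

end

/-! ### Assembly of the two lower bounds. -/

theorem theorem4 :
    -- strong regret, for each subgroup model and each law of the customer feature
    (∃ c : ℝ, 0 < c ∧ ∀ xbar Lbar : ℝ, 0 < xbar → 0 < Lbar →
      ∃ M₀ κ₀ h₀ : ℝ, 0 < M₀ ∧ 0 < κ₀ ∧ 0 < h₀ ∧
      ∀ ξ M κz κ C hbar : ℝ, 0 < ξ → ξ < 1 / 2 → 1 < M → M₀ ≤ M → 0 < κz → κ₀ + κz ≤ κ →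
        0 < C → 0 < hbar → hbar ≤ h₀ →
      ∀ σ : NNReal, 0 < σ → ∀ (K d s T : ℕ) [NeZero K], 2 ≤ K → 1 ≤ s → s ≤ d →
      ∀ (θ : Fin d → ℝ) (ν : MeasureTheory.Measure (Fin d → ℝ)),
        MeasureTheory.IsProbabilityMeasure ν →
        LatentBandit.IsSparse s θ → LatentBandit.NondegenerateGroups ξ θ ν →
        LatentBandit.IsSubGaussian ν id κz →
        LatentBandit.EigenvaluesWithin M (LatentBandit.secondMoment ν id) →
      ∀ π : LatentBandit.Policy K d, ∃ μ : LatentBandit.Instance K d,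
        LatentBandit.InClass s xbar Lbar ξ M κ C hbar μ ∧ μ.θ = θ ∧ μ.zLaw = ν ∧
        c * (xbar * Lbar * LatentBandit.misclassError θ ν * T) ≤
          LatentBandit.strongRegret μ σ π T) ∧
    -- regular regret
    (∀ A ξ : ℝ, 0 < A → 0 < ξ → ξ < 1 / 2 →
      ∃ c : ℝ, 0 < c ∧ ∀ xbar Lbar : ℝ, 0 < xbar → 0 < Lbar →
      ∃ M₀ κ₀ h₀ : ℝ, 0 < M₀ ∧ 0 < κ₀ ∧ 0 < h₀ ∧
      ∀ M κ C hbar : ℝ, 1 < M → M₀ ≤ M → κ₀ ≤ κ → 0 < C → 0 < hbar → hbar ≤ h₀ →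
      ∀ σ : NNReal, 0 < σ → ∀ (K d s T : ℕ) [NeZero K], 2 ≤ K → 1 ≤ s → s ≤ d →
        Real.log d ≤ A * Real.log (d / s) → s * Real.log d ≤ A * T →
      ∀ π : LatentBandit.Policy K d, ∃ μ : LatentBandit.Instance K d,
        LatentBandit.InClass s xbar Lbar ξ M κ C hbar μ ∧
        c * (xbar * Lbar * Real.sqrt (s * Real.log d) * Real.sqrt T) ≤
          LatentBandit.regularRegret μ σ π T) := by
  refine ⟨⟨2, by norm_num, fun xbar Lbar hx hL => ⟨xbar ^ 2 + 4 / xbar ^ 2 + 1, 2 * xbar,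
    xbar * Lbar / 4, by positivity, by positivity, by positivity, ?_⟩⟩, ?_⟩
  · intro ξ M κz κ C hbar hξ hξ' hM1 hM hκz hκ hC hh0 hh σ hσ K d s T _ hK hs hsd θ ν hν hθ hnd
      hsub heig π
    have : NeZero d := ⟨by omega⟩
    have hx2 : 0 < xbar ^ 2 := by positivity
    have hx4 : 0 < 4 / xbar ^ 2 := by positivity
    refine ⟨LatentBandit.signInstance K xbar Lbar θ ν, LatentBandit.inClass_signInstance hK hs hx
      hL hM1 (by linarith) (by linarith) hκz hκ hC hh hθ hnd hsub heig, rfl,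
      LatentBandit.zLaw_signInstance, ?_⟩
    have h := Finset.sum_le_sum fun n (_ : n ∈ Finset.range T) =>
      LatentBandit.le_integral_instantStrong (θ := θ) (ν := ν) σ π n hK hx hL
    simp only [Finset.sum_const, Finset.card_range, nsmul_eq_mul] at h
    rw [LatentBandit.strongRegret]
    linarith
  · intro A ξ hA hξ hξ'
    set L := Real.log ((1 - ξ) / ξ) with hLdef
    have hLpos : 0 < L := Real.log_pos (by rw [lt_div_iff₀ hξ]; linarith)
    -- The half-width b depends on ξ only: b < L gives nondegeneracy on the slab, and b ≤ 1 gives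
    -- the linear lower bound on the bias.
    obtain ⟨b, hb, hb1, hbL⟩ : ∃ b : ℝ, 0 < b ∧ b ≤ 1 ∧ b < L :=
      ⟨min 1 (L / 2), by positivity, min_le_left _ _, (min_le_right _ _).trans_lt (by linarith)⟩
    refine ⟨√(b ^ 2 / (4608 * (1 + A)) / A) / 24, by positivity, fun xbar Lbar hx hL =>
      ⟨xbar ^ 2 + 4 / xbar ^ 2 + 4, 2 * xbar + 2, xbar * Lbar / 4, by positivity, by positivity,
        by positivity, ?_⟩⟩
    intro M κ C hbar hM1 hM hκ hC hh0 hh σ hσ K d s T _ hK hs hsd hA1 hA2 π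
    have : NeZero d := ⟨by omega⟩
    have hx2 : 0 < xbar ^ 2 := by positivity
    have hx4 : 0 < 4 / xbar ^ 2 := by positivity
    have ht : 0 < xbar * Lbar := mul_pos hx hL
    rcases (show d = 1 ∨ 2 ≤ d by omega) with hd | hd
    -- For d = 1 the claimed bound is 0 and any instance of the class whose regret vanishes
    -- suffices: with θ = 0 the group bias is zero. The choice of η needs log d > 0 (and T > 0,
    -- which follows from it).
    · have hq : (LatentBandit.signLaw d).real (LatentBandit.slab 0 b)ᶜ ≤ 1 / 24 :=
        (LatentBandit.signLaw_real_slab_compl_le 0 hb).trans (by norm_num)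
      have := LatentBandit.isProbabilityMeasure_slabLaw hq
      refine ⟨_, LatentBandit.inClass_slabLaw (θ := 0) hK hs hx hL hξ hξ' hbL (by linarith)
        (by linarith) (by linarith) hκ hC hh (by simp [LatentBandit.IsSparse]) hq, ?_⟩
      have h0 : LatentBandit.groupBias 0 = 0 := by
        rw [LatentBandit.groupBias, LatentBandit.sigmoid_zero_eq]; norm_num
      rw [LatentBandit.regularRegret]
      simp [hd, LatentBandit.integral_instantRegular σ π _ hK hx hL, h0]
    · have hm : 0 < d / s := Nat.div_pos hsd hs
      obtain ⟨η, hη0, hηT, hηb, hkey⟩ := LatentBandit.exists_spike_size hA hb hd hs hsd hA1 hA2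
      have hsm : s * (d / s) ≤ d := Nat.mul_div_le d s
      -- The s blocks of length ⌊d/s⌋ fill the initial s⌊d/s⌋ coordinates; the remainder stays
      -- unused.
      set pos : Fin s × Fin (d / s) → Fin d := fun p => Fin.castLE hsm (finProdFinEquiv p) with hposdef
      have hpos : Function.Injective pos :=
        (Fin.castLE_injective hsm).comp finProdFinEquiv.injective
      have hq : ∀ ω, (LatentBandit.signLaw d).real
          (LatentBandit.slab (LatentBandit.spikes pos η ω) b)ᶜ ≤ 1 / 24 := fun ω => by
        refine (LatentBandit.signLaw_real_slab_compl_le _ hb).trans ?_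
        have h1 : (48 * (η * √s)) ^ 2 ≤ b ^ 2 := pow_le_pow_left₀ (by positivity) hηb 2
        rw [LatentBandit.sum_spikes_sq hpos, div_le_iff₀ (by positivity)]
        rw [mul_pow, mul_pow, Real.sq_sqrt (Nat.cast_nonneg s)] at h1
        nlinarith
      have := fun ω => LatentBandit.isProbabilityMeasure_slabLaw (hq ω)
      obtain ⟨ω, hω⟩ := LatentBandit.exists_le_regularRegret (T := T) hK hx hL hs hm hpos hb hb1 hη0
        hηT hηb hq σ π
      refine ⟨_, LatentBandit.inClass_slabLaw hK hs hx hL hξ hξ' hbL (by linarith)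
        (by linarith) (by linarith) hκ hC hh (LatentBandit.isSparse_spikes pos η ω) (hq ω),
        le_trans ?_ hω⟩
      have := mul_le_mul_of_nonneg_left hkey (show 0 ≤ xbar * Lbar / 24 by positivity)
      linarith
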